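/- For a field $K$, let $\mathcal X(K)$ be the set of all orders of $K$, with the topology having the Harrison sets $H(a)=\{P\in\mathcal X(K): a\in P\}$, $a\in K\setminus\{0\}$, as a subbase. Let $M(K)$ be the set of all $\mathbb R$-places of $K$ (places $\xi:K\to\mathbb R\cup\{\infty\}$), with the quotient topology for the canonical map $\lambda_K:\mathcal X(K)\to M(K)$ that sends an order $P$ to the place with valuation ring $\{a\in K:\ q\pm a\in P\text{ for some } q\in\mathbb Q,\ q>0\}$ obtained by embedding its Archimedean ordered residue field into $\mathbb R$. A cut of an ordered field $K$ is a pair $(A,B)$ of subsets with $A\cup B=K$ and $a<b$ for all $a\in A$, $b\in B$. It is normal if for every $c>0$ in $K$ there are $a\in A$, $b\in B$ with $b-a<c$, and principal if $A$ has a greatest element or $B$ has a least element. An ordered field is continuous closed if every normal cut in it is principal. An ordered field extension $\tilde K$ of $K$ is a continuous closure of $K$ if $\tilde K$ is continuous closed and $K$ is dense in $\tilde K$ (that is, for all $x<y$ in $\tilde K$ there is $r\in K$ with $x<r<y$). Theorem. Let $R$ be a real closed field and let $\tilde R$ be a continuous closure of $R$. Then the restriction map $$M(\tilde R(X))\to M(R(X)),\qquad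 \xi\mapsto \xi|_{R(X)},$$ is a homeomorphism. In particular, the spaces $M(R(X))$ and $M(\tilde R(X))$ are homeomorphic. -/

import Mathlib

/-! ### Orders of a field -/

/-- The set `𝒳(K)` of all orders of the field `K`. An order is given by its set `P` of
nonnegative elements. -/
def FieldOrder (K : Type*) [Field K] : Type _ :=
  {P : RingPreordering K // P.IsOrdering}

namespace FieldOrder

variable {K : Type*} [Field K]

/-- The Harrison set `H(a)` of all orders in which `a` is nonnegative (equivalently positive,
when `a ≠ 0`). -/
def harrisonSet (a : K) : Set (FieldOrder K) := {P | a ∈ P.1}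

/-- The Harrison topology: the sets `H(a)`, `a ≠ 0`, form a subbase. -/
instance : TopologicalSpace (FieldOrder K) :=
  TopologicalSpace.generateFrom {U | ∃ a : K, a ≠ 0 ∧ U = harrisonSet a}

/-- The linear order relation on `K` attached to an order `P`: `a ≤ b` iff `b - a ∈ P`. -/
noncomputable abbrev toLinearOrder (P : FieldOrder K) : LinearOrder K where
  le a b := b - a ∈ P.1
  le_refl a := by simp
  le_trans a b c hab hbc := by
    have h := add_mem hab hbc
    rwa [show b - a + (c - b) = c - a by ring] at h
  le_antisymm a b hab hba := by
    have h : b - a = 0 :=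
      RingPreordering.eq_zero_of_mem_of_neg_mem hab (by rwa [neg_sub])
    exact (sub_eq_zero.mp h).symm
  le_total a b := by
    have : P.1.IsOrdering := P.2
    rcases mem_or_neg_mem P.1 (b - a) with h | h
    · exact Or.inl h
    · exact Or.inr (by rwa [neg_sub] at h)
  toDecidableLE := Classical.decRel _

theorem toLinearOrder_isOrderedRing (P : FieldOrder K) :
    @IsOrderedRing K _ P.toLinearOrder.toPartialOrder := by
  let := P.toLinearOrder
  have hadd : ∀ a b : K, a ≤ b → ∀ c : K, a + c ≤ b + c := by
    intro a b h c
    change b + c - (a + c) ∈ P.1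
    rwa [add_sub_add_right_eq_sub]
  have : IsOrderedAddMonoid K := { add_le_add_left := hadd }
  have : ZeroLEOneClass K := ⟨by
    change (1 : K) - 0 ∈ P.1
    simp⟩
  refine @IsOrderedRing.of_mul_nonneg K _ _ _ _ ?_
  · intro a b ha hb
    have ha' : a - 0 ∈ P.1 := ha
    have hb' : b - 0 ∈ P.1 := hb
    change a * b - 0 ∈ P.1
    rw [sub_zero] at *
    exact mul_mem ha' hb'

end FieldOrder

/-! ### Real places -/

/-- An `ℝ`-place of `K`, that is, a place `K → ℝ ∪ {∞}`: a valuation ring of `K` (the elements with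
a finite value), together with a ring homomorphism from it to `ℝ` which vanishes on those elements
whose inverse has value `∞`. -/
structure RealPlace (K : Type*) [Field K] where
  /-- The elements at which the place is finite. -/
  valuationSubring : ValuationSubring K
  /-- The finite values of the place. -/
  toRingHom : valuationSubring →+* ℝ
  map_eq_zero : ∀ a : valuationSubring, (a : K)⁻¹ ∉ valuationSubring → toRingHom a = 0

/-- For an ordered field, `a` lies in the valuation ring `{a | ∃ q ∈ ℚ, q > 0, q ± a ≥ 0}`
iff its Archimedean class is nonnegative. -/
theorem exists_rat_bound_iff {K : Type*} [Field K] [LinearOrder K] [IsOrderedRing K] (a : K) :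
    (∃ q : ℚ, 0 < q ∧ 0 ≤ (q : K) + a ∧ 0 ≤ (q : K) - a) ↔ 0 ≤ ArchimedeanClass.mk a := by
  have := IsOrderedRing.toIsStrictOrderedRing K
  rw [show (0 : ArchimedeanClass K) = ArchimedeanClass.mk 1 from rfl,
    ArchimedeanClass.mk_le_mk]
  constructor
  · rintro ⟨q, hq, h1, h2⟩
    obtain ⟨n, hn⟩ := exists_nat_ge q
    refine ⟨n, ?_⟩
    have : (q : K) ≤ n := by exact_mod_cast hn
    rw [abs_one, nsmul_one, abs_le]
    constructor <;> linarith
  · rintro ⟨n, hn⟩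
    rw [abs_one, nsmul_one, abs_le] at hn
    refine ⟨n + 1, by positivity, ?_, ?_⟩ <;> push_cast <;> linarith [hn.1, hn.2]

/-- The `ℝ`-place of an ordered field. Its valuation ring is `{a | ∃ q ∈ ℚ, q > 0, q ± a ≥ 0}`, and
its finite values are obtained by embedding the (Archimedean ordered) residue field into `ℝ`; this
is the standard part. -/
noncomputable def RealPlace.ofOrderedField (K : Type*) [Field K] [LinearOrder K]
    [IsOrderedRing K] : RealPlace K where
  valuationSubring :=
    { carrier := {a | ∃ q : ℚ, 0 < q ∧ 0 ≤ (q : K) + a ∧ 0 ≤ (q : K) - a}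
      mul_mem' := by
        intro a b ha hb
        have ha' := (exists_rat_bound_iff a).1 ha
        have hb' := (exists_rat_bound_iff b).1 hb
        exact (exists_rat_bound_iff _).2 (by
          rw [ArchimedeanClass.mk_mul]; exact add_nonneg ha' hb')
      one_mem' := (exists_rat_bound_iff 1).2 le_rfl
      add_mem' := by
        intro a b ha hb
        have ha' := (exists_rat_bound_iff a).1 ha
        have hb' := (exists_rat_bound_iff b).1 hb
        exact (exists_rat_bound_iff _).2 ((le_min ha' hb').trans (ArchimedeanClass.min_le_mk_add ..))
      zero_mem' := (exists_rat_bound_iff 0).2 (by simp)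
      neg_mem' := by
        intro a ha
        have ha' := (exists_rat_bound_iff a).1 ha
        exact (exists_rat_bound_iff _).2 (by rwa [ArchimedeanClass.mk_neg])
      mem_or_inv_mem' := by
        intro a
        have h : 0 ≤ ArchimedeanClass.mk a ∨ 0 ≤ ArchimedeanClass.mk a⁻¹ := by
          by_cases ha : a = 0
          · left; simp [ha]
          · rcases le_total 0 (ArchimedeanClass.mk a) with h | h
            · exact Or.inl h
            · right
              by_contra hlt
              have hlt' := not_le.1 hlt
              have h1 : ArchimedeanClass.mk a + ArchimedeanClass.mk a⁻¹ = 0 := by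
                rw [← ArchimedeanClass.mk_mul, mul_inv_cancel₀ ha, ArchimedeanClass.mk_one]
              have h2 : ArchimedeanClass.mk a + ArchimedeanClass.mk a⁻¹
                  ≤ ArchimedeanClass.mk a⁻¹ := by
                simpa using add_le_add_left h (ArchimedeanClass.mk a⁻¹)
              rw [h1] at h2
              exact hlt h2
        exact h.imp (exists_rat_bound_iff _).2 (exists_rat_bound_iff _).2 }
  toRingHom :=
    { toFun := fun a => ArchimedeanClass.stdPart (a : K)
      map_one' := ArchimedeanClass.stdPart_one
      map_zero' := ArchimedeanClass.stdPart_zero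
      map_mul' := fun a b => ArchimedeanClass.stdPart_mul
        ((exists_rat_bound_iff _).1 a.2) ((exists_rat_bound_iff _).1 b.2)
      map_add' := fun a b => ArchimedeanClass.stdPart_add
        ((exists_rat_bound_iff _).1 a.2) ((exists_rat_bound_iff _).1 b.2) }
  map_eq_zero := by
    intro a ha
    refine ArchimedeanClass.stdPart_eq_zero.2 fun h => ha ((exists_rat_bound_iff _).2 ?_)
    rw [ArchimedeanClass.mk_inv, h, neg_zero]

/-- The canonical map `λ : 𝒳(K) → M(K)` from orders to `ℝ`-places. -/
noncomputable def FieldOrder.toRealPlace {K : Type*} [Field K] (P : FieldOrder K) : RealPlace K :=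
  @RealPlace.ofOrderedField K _ P.toLinearOrder P.toLinearOrder_isOrderedRing

/-- The space `M(K)` of `ℝ`-places carries the quotient topology for `λ : 𝒳(K) → M(K)`. -/
noncomputable instance RealPlace.instTopologicalSpace (K : Type*) [Field K] : TopologicalSpace (RealPlace K) :=
  TopologicalSpace.coinduced FieldOrder.toRealPlace inferInstance

/-- The restriction `ξ ↦ ξ ∘ f` of `ℝ`-places along a field embedding `f : K → L`. -/
def RealPlace.comap {K L : Type*} [Field K] [Field L] (f : K →+* L) (ξ : RealPlace L) :
    RealPlace K where
  valuationSubring := ξ.valuationSubring.comap f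
  toRingHom := ξ.toRingHom.comp
    (f.restrict (ξ.valuationSubring.comap f) ξ.valuationSubring fun _ hx => hx)
  map_eq_zero a ha := ξ.map_eq_zero _ (by
    intro h
    apply ha
    rw [ValuationSubring.mem_comap, map_inv₀]
    exact h)

/-! ### Cuts and the continuous closure -/

/-- `(A, B)` is a (Dedekind) cut of the linearly ordered set `K`. -/
structure IsCut {K : Type*} [LinearOrder K] (A B : Set K) : Prop where
  union_eq : A ∪ B = Set.univ
  lt : ∀ a ∈ A, ∀ b ∈ B, a < b

/-- A cut `(A, B)` of an ordered field is normal if for each `c > 0` there are `a ∈ A` and `b ∈ B`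
with `b - a < c`. -/
def IsNormalCut {K : Type*} [Field K] [LinearOrder K] (A B : Set K) : Prop :=
  IsCut A B ∧ ∀ c : K, 0 < c → ∃ a ∈ A, ∃ b ∈ B, b - a < c

/-- A cut `(A, B)` is principal if `A` has a greatest or `B` has a least element. -/
def IsPrincipalCut {K : Type*} [LinearOrder K] (A B : Set K) : Prop :=
  IsCut A B ∧ ((∃ a, IsGreatest A a) ∨ ∃ b, IsLeast B b)

/-- An ordered field is continuous closed if each of its normal cuts is principal. -/
def IsContinuousClosed (K : Type*) [Field K] [LinearOrder K] : Prop :=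
  ∀ A B : Set K, IsNormalCut A B → IsPrincipalCut A B

/-- The ordered field extension `L` of `K` is a continuous closure of `K`: `L` is continuous closed
and `K` is dense in `L`. -/
structure IsContinuousClosure (K L : Type*) [Field K] [LinearOrder K] [Field L] [LinearOrder L]
    [Algebra K L] : Prop where
  strictMono : StrictMono (algebraMap K L)
  continuousClosed : IsContinuousClosed L
  dense : ∀ x y : L, x < y → ∃ r : K, x < algebraMap K L r ∧ algebraMap K L r < y

/-- The inclusion `R(X) → S(X)` of rational function fields induced by a field extension `S/R`. -/
noncomputable def ratFuncInclusion (R S : Type*) [Field R] [Field S] [Algebra R S] :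
    RatFunc R →+* RatFunc S :=
  RatFunc.mapRingHom (Polynomial.mapRingHom (algebraMap R S))
    (nonZeroDivisors_le_comap_nonZeroDivisors_of_injective _
      (Polynomial.map_injective _ (algebraMap R S).injective))

/-!
Restriction of orders and restriction of places fit into a commutative square

    `λ ∘ FieldOrder.comap f = RealPlace.comap f ∘ λ`

for every field embedding `f`, and `λ` is surjective for every field (the Baer-Krull theorem in its
weakest form, `FieldOrder.toRealPlace_surjective`). Spaces of orders are compact Hausdorff, so as
soon as all orders extend along `f`, restriction of orders is a quotient map, hence so is
restriction of places (`RealPlace.isQuotientMap_comap`). An injective quotient map is a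
homeomorphism. For the inclusion of `R(X)` into `S(X)` two things remain.

*Orders extend* (`FieldOrder.comap_ratFuncInclusion_surjective`). Over a real closed field every
polynomial is a product of constants, linear factors and positive quadratics, so in a given order of
`R(X)` it has the sign of its values at those `r` in `R` which lie close to `X` in the cut that `X`
makes in `R`. An ultrafilter of such `r` maps `S(X)` into an ultrapower of `S`, by evaluation; the
order which this induces on `S(X)` extends the given one.

*Restriction of places is injective* (`FieldOrder.comap_ratFuncInclusion_injective`). Every
nonnegative element of `S` is a square, because approximations from `R` give a normal cut at its
square root; so all orders of `S(X)` agree on `S`. In an order of `S(X)` one of two things happens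
(`IsContinuousClosure.exists_forall_le_or_exists_forall_lt`).
* `X` has distance at least `δ(1 + |X|)` from all elements of `R`, for some positive `δ` in `S`.
  Then polynomials over `S` are bounded below and are approximated, up to a small relative error, by
  polynomials over `R` with nearby coefficients.
* `X` defines a normal cut of `S`. This is principal, so `X` is infinitesimally close to an element
  `a` of `S`, and the place is determined by `a`: it is evaluation at `a`, followed by the natural
  place of `S`.
Let two orders have places which agree on `R(X)`. If `X` is infinitesimally close to `a` in one of
them, then it is so in the other. Hence the same case occurs for both orders, and in either case
their places on `S(X)` are equal.
-/

/-! ### Extending preorderings to orderings -/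

namespace RingPreordering

variable {K : Type*} [Field K]

/-- The preordering `P + aP` generated by a preordering `P` and an element `a` with `-a ∉ P`. -/
def adjoin (P : RingPreordering K) (a : K) (ha : -a ∉ P) : RingPreordering K :=
  RingPreordering.mk' {z | ∃ x ∈ P, ∃ y ∈ P, z = x + a * y}
    (by
      rintro _ _ ⟨x, hx, y, hy, rfl⟩ ⟨x', hx', y', hy', rfl⟩
      exact ⟨x + x', add_mem hx hx', y + y', add_mem hy hy', by ring⟩)
    (by
      rintro _ _ ⟨x, hx, y, hy, rfl⟩ ⟨x', hx', y', hy', rfl⟩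
      exact ⟨x * x' + a * a * (y * y'),
        add_mem (mul_mem hx hx') (mul_mem (P.mul_self_mem a) (mul_mem hy hy')),
        x * y' + y * x', add_mem (mul_mem hx hy') (mul_mem hy hx'), by ring⟩)
    (fun x => ⟨x * x, P.mul_self_mem x, 0, zero_mem P, by simp⟩)
    (by
      rintro ⟨x, hx, y, hy, h⟩
      have hy0 : y ≠ 0 := by
        rintro rfl
        apply RingPreordering.neg_one_notMem P
        rw [h]
        simpa using hx
      apply ha
      -- `-a * y = 1 + x`, so `-a = (1 + x) * y * (1 / y) ^ 2` lies in `P`.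
      have : -a = (1 + x) * y * (y⁻¹ * y⁻¹) := by
        field_simp
        linear_combination h
      rw [this]
      exact mul_mem (mul_mem (add_mem (one_mem P) hx) hy) (P.mul_self_mem _))

/-- An ordering is obtained as a maximal preordering. -/
theorem exists_isOrdering_le (T : RingPreordering K) :
    ∃ P : RingPreordering K, T ≤ P ∧ P.IsOrdering := by
  obtain ⟨P, hTP, hP⟩ := zorn_le_nonempty_Ici₀ T (fun c hcT hc y hy => by
    refine ⟨RingPreordering.mk' {z | ∃ Q ∈ c, z ∈ Q} ?_ ?_ ?_ ?_, ?_⟩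
    · rintro x z ⟨Q, hQ, hx⟩ ⟨Q', hQ', hz⟩
      rcases hc.total hQ hQ' with h | h
      · exact ⟨Q', hQ', add_mem (h hx) hz⟩
      · exact ⟨Q, hQ, add_mem hx (h hz)⟩
    · rintro x z ⟨Q, hQ, hx⟩ ⟨Q', hQ', hz⟩
      rcases hc.total hQ hQ' with h | h
      · exact ⟨Q', hQ', mul_mem (h hx) hz⟩
      · exact ⟨Q, hQ, mul_mem hx (h hz)⟩
    · exact fun x => ⟨y, hy, y.mul_self_mem x⟩
    · rintro ⟨Q, -, h⟩
      exact Q.neg_one_notMem h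
    · exact fun Q hQ z hz => ⟨Q, hQ, hz⟩) T le_rfl
  refine ⟨P, hTP, ?_⟩
  have : HasMemOrNegMem P := ⟨fun a => by
    by_contra! h
    have hle : P ≤ P.adjoin a h.2 := fun z hz => ⟨z, hz, 0, zero_mem P, by simp⟩
    exact h.1 (hP hle ⟨0, zero_mem P, 1, one_mem P, by simp⟩)⟩
  exact { ne_top' := support_ne_top P, mem_or_mem' := Ideal.IsPrime.mem_or_mem inferInstance }

end RingPreordering

/-! ### The real place of an order -/

namespace RealPlace

variable {K L : Type*} [Field K] [Field L]

theorem ext_of_apply_eq {ξ η : RealPlace K}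
    (h : ∀ a, a ∈ ξ.valuationSubring ↔ a ∈ η.valuationSubring)
    (h' : ∀ a (ha : a ∈ ξ.valuationSubring) (ha' : a ∈ η.valuationSubring),
      ξ.toRingHom ⟨a, ha⟩ = η.toRingHom ⟨a, ha'⟩) : ξ = η := by
  obtain ⟨V, f, hf⟩ := ξ
  obtain ⟨W, g, hg⟩ := η
  obtain rfl : V = W := SetLike.ext h
  obtain rfl : f = g := RingHom.ext fun a => h' a a.2 a.2
  rfl

theorem map_eq_zero_of_notMem (ξ : RealPlace L) {a : L} (ha : a ∉ ξ.valuationSubring) :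
    ∃ h : a⁻¹ ∈ ξ.valuationSubring, ξ.toRingHom ⟨a⁻¹, h⟩ = 0 := by
  refine ⟨(ξ.valuationSubring.mem_or_inv_mem a).resolve_left ha, ξ.map_eq_zero _ ?_⟩
  simpa using ha

theorem ratCast_mem [CharZero K] (ξ : RealPlace K) (q : ℚ) : (q : K) ∈ ξ.valuationSubring := by
  have hn : ((q.den : K))⁻¹ ∈ ξ.valuationSubring := by
    by_contra h
    obtain ⟨h1, h2⟩ := map_eq_zero_of_notMem ξ h
    have h3 : (⟨(q.den : K)⁻¹⁻¹, h1⟩ : ξ.valuationSubring) = (q.den : ξ.valuationSubring) :=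
      Subtype.ext (by simp)
    rw [h3, map_natCast, Nat.cast_eq_zero] at h2
    exact q.den_nz h2
  rw [Rat.cast_def, div_eq_mul_inv]
  exact mul_mem (intCast_mem _ _) hn

theorem apply_ratCast [CharZero K] (ξ : RealPlace K) (q : ℚ) :
    ξ.toRingHom ⟨(q : K), ξ.ratCast_mem q⟩ = q := by
  have hd : (q.den : ℝ) ≠ 0 := by exact_mod_cast q.den_nz
  have h : (⟨(q : K), ξ.ratCast_mem q⟩ : ξ.valuationSubring) * (q.den : ξ.valuationSubring) =
      (q.num : ξ.valuationSubring) := Subtype.ext (by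
    push_cast
    exact_mod_cast congrArg (Rat.cast (K := K)) (Rat.mul_den_eq_num q))
  have h' := congrArg ξ.toRingHom h
  rw [map_mul, map_natCast, map_intCast] at h'
  rw [eq_div_of_mul_eq hd h', Rat.cast_def]

section OrderedField

variable [LinearOrder K] [IsOrderedRing K]

theorem mem_ofOrderedField {a : K} :
    a ∈ (ofOrderedField K).valuationSubring ↔
      ∃ q : ℚ, 0 < q ∧ 0 ≤ (q : K) + a ∧ 0 ≤ (q : K) - a := Iff.rfl

theorem ofOrderedField_mono {a b : (ofOrderedField K).valuationSubring} (h : (a : K) ≤ b) :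
    (ofOrderedField K).toRingHom a ≤ (ofOrderedField K).toRingHom b :=
  ArchimedeanClass.stdPart_monotoneOn ((exists_rat_bound_iff _).1 a.2)
    ((exists_rat_bound_iff _).1 b.2) h

theorem pos_of_ofOrderedField_pos {a : (ofOrderedField K).valuationSubring}
    (h : 0 < (ofOrderedField K).toRingHom a) : 0 < (a : K) := by
  by_contra! h'
  have := ofOrderedField_mono (b := 0) (a := a) h'
  rw [map_zero] at this
  exact this.not_gt h

/-- A real place of an ordered field is the natural one as soon as it only takes positive values
on nonnegative elements. -/
theorem ofOrderedField_eq {ξ : RealPlace K}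
    (H : ∀ a : ξ.valuationSubring, 0 < ξ.toRingHom a → 0 ≤ (a : K)) : ofOrderedField K = ξ := by
  have := IsOrderedRing.toIsStrictOrderedRing K
  have hle (q : ℚ) (a : ξ.valuationSubring) (h : (q : ℝ) < ξ.toRingHom a) : (q : K) ≤ a := by
    have := H (a - ⟨q, ξ.ratCast_mem q⟩) (by simpa [apply_ratCast] using h)
    simpa using this
  have hge (q : ℚ) (a : ξ.valuationSubring) (h : ξ.toRingHom a < q) : (a : K) ≤ q := by
    have := H (⟨q, ξ.ratCast_mem q⟩ - a) (by simpa [apply_ratCast] using h)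
    simpa using this
  have hV (a : K) : a ∈ (ofOrderedField K).valuationSubring ↔ a ∈ ξ.valuationSubring := by
    refine ⟨fun ha => ?_, fun ha => ?_⟩
    · by_contra hn
      obtain ⟨q, hq, h1, h2⟩ := mem_ofOrderedField.1 ha
      obtain ⟨hi, h0⟩ := map_eq_zero_of_notMem ξ hn
      have ha0 : a ≠ 0 := by
        rintro rfl
        exact hn (zero_mem _)
      have h3 := hle (-(2 * q)⁻¹) ⟨a⁻¹, hi⟩ (by rw [h0]; push_cast; simp; exact_mod_cast hq)
      have h4 := hge ((2 * q)⁻¹) ⟨a⁻¹, hi⟩ (by rw [h0]; push_cast; simp; exact_mod_cast hq)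
      have hq' : (0 : K) < q := by exact_mod_cast hq
      have h5 : |a| ≤ q := abs_le.2 ⟨by linarith, by linarith⟩
      have h6 : |a⁻¹| ≤ (2 * (q : K))⁻¹ := abs_le.2
        ⟨by simpa using h3, by simpa using h4⟩
      have h7 : |a| * |a⁻¹| ≤ q * (2 * (q : K))⁻¹ := by gcongr
      rw [← abs_mul, mul_inv_cancel₀ ha0, abs_one] at h7
      field_simp at h7
      linarith
    · obtain ⟨q, hq⟩ := exists_rat_gt |ξ.toRingHom ⟨a, ha⟩|
      have hq' := abs_lt.1 hq
      have h1 := hle (-q) ⟨a, ha⟩ (by push_cast; exact hq'.1)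
      have h2 := hge q ⟨a, ha⟩ hq'.2
      refine mem_ofOrderedField.2 ⟨q, ?_, ?_, ?_⟩
      · have := (abs_nonneg _).trans_lt hq
        exact_mod_cast this
      · push_cast at h1
        linarith
      · simp only at h2
        linarith
  refine ext_of_apply_eq hV fun a ha ha' => le_antisymm ?_ ?_
  · refine le_of_forall_gt_imp_ge_of_dense fun r hr => ?_
    obtain ⟨q, hq, hqr⟩ := exists_rat_btwn hr
    have := ofOrderedField_mono (a := ⟨a, ha⟩) (b := ⟨q, ratCast_mem _ q⟩)
      (hge q ⟨a, ha'⟩ hq)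
    rw [apply_ratCast] at this
    exact this.trans hqr.le
  · refine le_of_forall_lt_imp_le_of_dense fun r hr => ?_
    obtain ⟨q, hq, hqr⟩ := exists_rat_btwn hr
    have := ofOrderedField_mono (b := ⟨a, ha⟩) (a := ⟨(q : K), ratCast_mem _ q⟩)
      (hle q ⟨a, ha'⟩ hqr)
    rw [apply_ratCast] at this
    exact hq.le.trans this

end OrderedField

end RealPlace

namespace FieldOrder

variable {K L : Type*} [Field K] [Field L]

theorem toRealPlace_eq {P : FieldOrder K} {ξ : RealPlace K}
    (H : ∀ a : ξ.valuationSubring, 0 < ξ.toRingHom a → (a : K) ∈ P.1) : P.toRealPlace = ξ :=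
  @RealPlace.ofOrderedField_eq K _ P.toLinearOrder P.toLinearOrder_isOrderedRing ξ fun a ha =>
    show (a : K) - 0 ∈ P.1 by simpa using H a ha

theorem mem_of_toRealPlace_pos {P : FieldOrder K} {a : P.toRealPlace.valuationSubring}
    (h : 0 < P.toRealPlace.toRingHom a) : (a : K) ∈ P.1 := by
  have : (a : K) - 0 ∈ P.1 := @le_of_lt K P.toLinearOrder.toPreorder _ _
    (@RealPlace.pos_of_ofOrderedField_pos K _ P.toLinearOrder P.toLinearOrder_isOrderedRing a h)
  simpa using this

end FieldOrder

namespace RealPlace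

variable {K : Type*} [Field K]

/-- The preordering of all `a² u` where `u` has a positive value at the place `ξ`. -/
def preordering (ξ : RealPlace K) : RingPreordering K :=
  RingPreordering.mk' {z | ∃ a : K, ∃ u : ξ.valuationSubring, 0 < ξ.toRingHom u ∧ z = a ^ 2 * u}
    (by
      -- Factor out the square of the larger of the two coefficients.
      have key (a b : K) (u v : ξ.valuationSubring) (hu : 0 < ξ.toRingHom u)
          (hv : 0 < ξ.toRingHom v) (ha : a ≠ 0) (hab : b * a⁻¹ ∈ ξ.valuationSubring) :
          ∃ c : K, ∃ w : ξ.valuationSubring, 0 < ξ.toRingHom w ∧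
            a ^ 2 * u + b ^ 2 * v = c ^ 2 * w := by
        refine ⟨a, u + ⟨_, hab⟩ ^ 2 * v, ?_, ?_⟩
        · rw [map_add, map_mul, map_pow]
          positivity
        · push_cast
          field_simp
      rintro _ _ ⟨a, u, hu, rfl⟩ ⟨b, v, hv, rfl⟩
      rcases eq_or_ne a 0 with rfl | ha
      · exact ⟨b, v, hv, by simp⟩
      rcases eq_or_ne b 0 with rfl | hb
      · exact ⟨a, u, hu, by simp⟩
      rcases ξ.valuationSubring.mem_or_inv_mem (b * a⁻¹) with h | h
      · exact key a b u v hu hv ha h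
      · rw [mul_inv_rev, inv_inv] at h
        obtain ⟨c, w, hw, h⟩ := key b a v u hv hu hb h
        exact ⟨c, w, hw, by rw [add_comm, h]⟩)
    (by
      rintro _ _ ⟨a, u, hu, rfl⟩ ⟨b, v, hv, rfl⟩
      exact ⟨a * b, u * v, by rw [map_mul]; positivity, by push_cast; ring⟩)
    (fun x => ⟨x, 1, by simp, by simp [sq]⟩)
    (by
      rintro ⟨a, u, hu, h⟩
      rcases ξ.valuationSubring.mem_or_inv_mem a with ha | ha
      · have h0 : (⟨a, ha⟩ : ξ.valuationSubring) ^ 2 * u = -1 := Subtype.ext (by simpa using h.symm)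
        have := congrArg ξ.toRingHom h0
        rw [map_mul, map_pow, map_neg, map_one] at this
        nlinarith [mul_nonneg (sq_nonneg (ξ.toRingHom ⟨a, ha⟩)) hu.le]
      · have h0 : u = -(⟨a⁻¹, ha⟩ : ξ.valuationSubring) ^ 2 := Subtype.ext (by
          have ha0 : a ≠ 0 := by
            rintro rfl
            simp at h
          push_cast
          field_simp
          linear_combination -h)
        rw [h0, map_neg, map_pow] at hu
        nlinarith [sq_nonneg (ξ.toRingHom ⟨a⁻¹, ha⟩)])

end RealPlace

/-- Every real place comes from an order, namely from any order in which the elements of positive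
value are nonnegative. -/
theorem FieldOrder.toRealPlace_surjective {K : Type*} [Field K] :
    Function.Surjective (FieldOrder.toRealPlace (K := K)) := fun ξ => by
  obtain ⟨P, hP, hord⟩ := ξ.preordering.exists_isOrdering_le
  exact ⟨⟨P, hord⟩, toRealPlace_eq fun a ha => hP ⟨1, a, ha, by simp⟩⟩

/-! ### The space of orders -/

namespace FieldOrder

variable {K L : Type*} [Field K] [Field L]

theorem ext_of_mem {P Q : FieldOrder K} (h : ∀ a, a ∈ P.1 → a ∈ Q.1) : P = Q := by
  have := P.2
  refine Subtype.ext (SetLike.ext fun a => ⟨h a, fun ha => ?_⟩)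
  refine (mem_or_neg_mem P.1 a).elim id fun hn => ?_
  rw [RingPreordering.eq_zero_of_mem_of_neg_mem ha (h _ hn)]
  exact zero_mem P.1

theorem isOpen_harrisonSet {a : K} (ha : a ≠ 0) : IsOpen (harrisonSet a) :=
  TopologicalSpace.isOpen_generateFrom_of_mem ⟨a, ha, rfl⟩

instance : T2Space (FieldOrder K) := ⟨fun P Q hPQ => by
  have hQ := Q.2
  obtain ⟨a, ha, haQ⟩ : ∃ a, a ∈ P.1 ∧ a ∉ Q.1 := by
    by_contra! h
    exact hPQ (ext_of_mem h)
  have ha0 : a ≠ 0 := by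
    rintro rfl
    exact haQ (zero_mem _)
  refine ⟨harrisonSet a, harrisonSet (-a), isOpen_harrisonSet ha0,
    isOpen_harrisonSet (neg_ne_zero.2 ha0), ha, (mem_or_neg_mem Q.1 a).resolve_left haQ, ?_⟩
  rw [Set.disjoint_left]
  exact fun O h1 h2 => ha0 (RingPreordering.eq_zero_of_mem_of_neg_mem h1 h2)⟩

/-- The order consisting of the elements that belong to almost all orders of an ultrafilter. -/
def ultraLimit (f : Ultrafilter (FieldOrder K)) : FieldOrder K :=
  let T : RingPreordering K :=
    RingPreordering.mk' {a : K | ∀ᶠ P in (f : Filter (FieldOrder K)), a ∈ P.1}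
    (fun hx hy => by
      filter_upwards [hx, hy] with P h1 h2
      exact add_mem h1 h2)
    (fun hx hy => by
      filter_upwards [hx, hy] with P h1 h2
      exact mul_mem h1 h2)
    (fun x => Filter.Eventually.of_forall fun P => P.1.mul_self_mem x)
    (fun h => by
      obtain ⟨P, hP⟩ := Filter.Eventually.exists h
      exact P.1.neg_one_notMem hP)
  ⟨T, T.isOrdering_iff.2 fun a b hab => Ultrafilter.eventually_or.1 <|
    Filter.Eventually.mono (f := (f : Filter (FieldOrder K))) hab fun P hP =>
      P.1.isOrdering_iff.1 P.2 a b hP⟩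

instance : CompactSpace (FieldOrder K) := ⟨isCompact_iff_ultrafilter_le_nhds.2 fun f _ => by
  refine ⟨ultraLimit f, trivial, ?_⟩
  rw [TopologicalSpace.nhds_generateFrom]
  refine le_iInf₂ fun s hs => ?_
  obtain ⟨hmem, a, -, rfl⟩ := hs
  have hmem : ∀ᶠ P in (f : Filter (FieldOrder K)), a ∈ P.1 := hmem
  exact Filter.le_principal_iff.2 hmem⟩

/-- The restriction of an order along a field embedding. -/
def comap (f : K →+* L) (P : FieldOrder L) : FieldOrder K :=
  let T : RingPreordering K := RingPreordering.mk' {a | f a ∈ P.1}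
    (fun hx hy => by simpa using add_mem hx hy)
    (fun hx hy => by simpa using mul_mem hx hy)
    (fun x => by simp)
    (by simpa using P.1.neg_one_notMem)
  ⟨T, T.isOrdering_iff.2 fun a b hab =>
    P.1.isOrdering_iff.1 P.2 (f a) (f b) (by simpa [T] using hab)⟩

theorem mem_comap {f : K →+* L} {P : FieldOrder L} {a : K} : a ∈ (P.comap f).1 ↔ f a ∈ P.1 :=
  Iff.rfl

theorem continuous_comap (f : K →+* L) : Continuous (comap f) :=
  continuous_generateFrom_iff.2 fun s hs => by
    obtain ⟨a, ha, rfl⟩ := hs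
    exact isOpen_harrisonSet (a := f a) ((map_ne_zero f).2 ha)

theorem toRealPlace_comap (f : K →+* L) (P : FieldOrder L) :
    (P.comap f).toRealPlace = P.toRealPlace.comap f :=
  toRealPlace_eq fun a ha => mem_of_toRealPlace_pos (P := P) (a := ⟨f a, a.2⟩) ha

theorem isQuotientMap_toRealPlace :
    Topology.IsQuotientMap (FieldOrder.toRealPlace (K := K)) :=
  ⟨⟨rfl⟩, toRealPlace_surjective⟩

end FieldOrder

/-- If restriction of orders along `f` is surjective, it is a closed map between compact Hausdorff
spaces, so restriction of places is a quotient map. -/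
theorem RealPlace.isQuotientMap_comap {K L : Type*} [Field K] [Field L] {f : K →+* L}
    (hf : Function.Surjective (FieldOrder.comap f)) :
    Topology.IsQuotientMap (RealPlace.comap f) := by
  have h1 : Topology.IsQuotientMap (FieldOrder.comap f) :=
    (FieldOrder.continuous_comap f).isClosedMap.isQuotientMap (FieldOrder.continuous_comap f) hf
  have h2 := FieldOrder.isQuotientMap_toRealPlace.comp h1
  have h3 : FieldOrder.toRealPlace ∘ FieldOrder.comap f =
      RealPlace.comap f ∘ FieldOrder.toRealPlace :=
    funext fun P => FieldOrder.toRealPlace_comap f P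
  rw [h3] at h2
  exact .of_comp FieldOrder.isQuotientMap_toRealPlace.continuous
    (FieldOrder.isQuotientMap_toRealPlace.continuous_iff.2 h2.continuous) h2

/-! ### Irreducible polynomials over a real closed field -/

section RealClosed

open Polynomial IntermediateField Module

theorem finrank_ne_two_of_forall_isSquare {F E : Type*} [Field F] [CharZero F] [Field E]
    [Algebra F E] [FiniteDimensional F E] (hF : ∀ x : F, IsSquare x) : finrank F E ≠ 2 := by
  intro h
  obtain ⟨α, hα⟩ := Field.exists_primitive_element F E
  have hint : IsIntegral F α := .of_finite F α
  have hdeg : (minpoly F α).natDegree = 2 := by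
    rw [← adjoin.finrank hint, hα, IntermediateField.finrank_top', h]
  have hlc : (minpoly F α).coeff 2 ≠ 0 := by
    rw [← hdeg, coeff_natDegree, minpoly.monic hint]
    exact one_ne_zero
  obtain ⟨s, hs⟩ := hF (discrim ((minpoly F α).coeff 2) ((minpoly F α).coeff 1)
    ((minpoly F α).coeff 0))
  obtain ⟨x, hx⟩ := exists_quadratic_eq_zero hlc ⟨s, hs⟩
  have hroot : (minpoly F α).IsRoot x := by
    rw [IsRoot, eval_eq_sum_range, hdeg]
    simp only [Finset.sum_range_succ, Finset.sum_range_zero]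
    linear_combination hx
  have : (minpoly F α).natDegree = 1 := natDegree_eq_of_degree_eq_some
    (degree_eq_one_of_irreducible_of_root (minpoly.irreducible hint) hroot)
  omega

variable {R : Type*} [Field R] [LinearOrder R] [IsStrictOrderedRing R] [IsRealClosed R]

theorem IsRealClosed.exists_sq_eq {x : R} (hx : 0 ≤ x) : ∃ y, 0 ≤ y ∧ y ^ 2 = x := by
  obtain ⟨y, rfl⟩ := IsRealClosed.nonneg_iff_isSquare.1 hx
  exact ⟨|y|, abs_nonneg y, by rw [sq_abs, sq]⟩

/-- The minimal polynomial of a primitive element has odd degree, hence a root. -/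
theorem IsRealClosed.finrank_eq_one_of_odd {E : Type*} [Field E] [Algebra R E]
    [FiniteDimensional R E] (h : Odd (finrank R E)) : finrank R E = 1 := by
  obtain ⟨α, hα⟩ := Field.exists_primitive_element R E
  have hint : IsIntegral R α := .of_finite R α
  have hdeg : (minpoly R α).natDegree = finrank R E := by
    rw [← adjoin.finrank hint, hα, IntermediateField.finrank_top']
  obtain ⟨x, hx⟩ := IsRealClosed.exists_isRoot_of_odd_natDegree (hdeg.symm ▸ h)
  rw [← hdeg]
  exact natDegree_eq_of_degree_eq_some
    (degree_eq_one_of_irreducible_of_root (minpoly.irreducible hint) hx)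

/-- The usual formula for the square root of a complex number: the real and imaginary parts have
squares `(n ± a) / 2`, where `n` is the absolute value of `a + b i`. -/
theorem IsRealClosed.exists_sq_eq_add_mul {E : Type*} [Field E] [Algebra R E] {i : E}
    (hi : i ^ 2 = -1) (a b : R) : ∃ c d : R,
      (algebraMap R E c + algebraMap R E d * i) ^ 2 = algebraMap R E a + algebraMap R E b * i := by
  obtain ⟨n, hn0, hn⟩ := exists_sq_eq (add_nonneg (sq_nonneg a) (sq_nonneg b))
  have han : |a| ≤ n := abs_le_of_sq_le_sq (by nlinarith [sq_nonneg b]) hn0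
  obtain ⟨h1, h2⟩ := abs_le.1 han
  obtain ⟨c, hc0, hc⟩ := exists_sq_eq (show 0 ≤ (n + a) / 2 by linarith)
  obtain ⟨d, hd0, hd⟩ := exists_sq_eq (show 0 ≤ (n - a) / 2 by linarith)
  have hcd : (2 * c * d) ^ 2 = b ^ 2 := by
    rw [mul_pow, mul_pow, hc, hd]
    linear_combination hn
  have key (d : R) (hd : d ^ 2 = (n - a) / 2) (h : 2 * c * d = b) :
      (algebraMap R E c + algebraMap R E d * i) ^ 2 = algebraMap R E a + algebraMap R E b * i := by
    have h3 : c ^ 2 - d ^ 2 = a := by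
      rw [hc, hd]
      ring
    rw [← h, ← h3]
    simp only [map_mul, map_sub, map_pow, map_ofNat]
    linear_combination (algebraMap R E d) ^ 2 * hi
  rcases sq_eq_sq_iff_eq_or_eq_neg.1 hcd with h | h
  · exact ⟨c, d, key d hd h⟩
  · exact ⟨c, -d, key (-d) (by simpa using hd) (by linear_combination -h)⟩

theorem exists_eq_add_mul_of_mem_adjoin {F E : Type*} [Field F] [Field E] [Algebra F E] {i : E}
    (hi : i ^ 2 = -1) {x : E} (hx : x ∈ F⟮i⟯) :
    ∃ a b : F, x = algebraMap F E a + algebraMap F E b * i := by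
  have hint : IsIntegral F i := ⟨X ^ 2 + 1, by monicity!, by simp [hi]⟩
  rw [← IntermediateField.mem_toSubalgebra,
    IntermediateField.adjoin_simple_toSubalgebra_of_isAlgebraic hint.isAlgebraic] at hx
  induction hx using Algebra.adjoin_induction with
  | mem x hx =>
    obtain rfl : x = i := hx
    exact ⟨0, 1, by simp⟩
  | algebraMap r => exact ⟨r, 0, by simp⟩
  | add x y _ _ hx hy =>
    obtain ⟨a, b, rfl⟩ := hx
    obtain ⟨c, d, rfl⟩ := hy
    exact ⟨a + c, b + d, by simp only [map_add]; ring⟩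
  | mul x y _ _ hx hy =>
    obtain ⟨a, b, rfl⟩ := hx
    obtain ⟨c, d, rfl⟩ := hy
    refine ⟨a * c - b * d, a * d + b * c, ?_⟩
    simp only [map_add, map_mul, map_sub]
    linear_combination (algebraMap F E b * algebraMap F E d) * hi

/-- By Sylow's theorem a Galois extension of a real closed field which contains a square root `i` of
`-1` has degree a power of two, and a degree larger than two would produce a quadratic
extension of the field generated by `i`, in which every element is a square. -/
theorem IsRealClosed.finrank_le_two {E : Type*} [Field E] [Algebra R E] [FiniteDimensional R E]
    [IsGalois R E] {i : E} (hi : i ^ 2 = -1) : finrank R E ≤ 2 := by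
  obtain ⟨n, m, hm, hnm⟩ := Nat.exists_eq_two_pow_mul_odd (finrank_pos (R := R) (M := E)).ne'
  have : Fact (Nat.Prime 2) := ⟨Nat.prime_two⟩
  obtain ⟨H, hH⟩ := Sylow.exists_subgroup_card_pow_prime (G := Gal(E/R)) 2 (n := n)
    (by rw [IsGalois.card_aut_eq_finrank, hnm]; exact dvd_mul_right _ _)
  have h1 := finrank_mul_finrank R (fixedField H) E
  rw [finrank_fixedField_eq_card, hH, hnm, mul_comm] at h1
  have h2 := Nat.eq_of_mul_eq_mul_left (by positivity) h1
  have h3 := finrank_eq_one_of_odd (h2.symm ▸ hm)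
  rw [← h2, h3, mul_one] at hnm
  have h4 := finrank_mul_finrank R R⟮i⟯ E
  obtain ⟨k, -, hk⟩ := (Nat.dvd_prime_pow Nat.prime_two).1
    (hnm ▸ Dvd.intro_left _ h4 : finrank R⟮i⟯ E ∣ 2 ^ n)
  have hsq (x : R⟮i⟯) : IsSquare x := by
    obtain ⟨a, b, hab⟩ := exists_eq_add_mul_of_mem_adjoin hi x.2
    obtain ⟨c, d, hcd⟩ := exists_sq_eq_add_mul hi a b
    refine ⟨algebraMap R R⟮i⟯ c + algebraMap R R⟮i⟯ d * AdjoinSimple.gen R i, Subtype.ext ?_⟩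
    rw [hab, ← hcd, sq]
    rfl
  have hk0 : k = 0 := by
    by_contra hk0
    obtain ⟨l, rfl⟩ := Nat.exists_eq_succ_of_ne_zero hk0
    obtain ⟨H', hH'⟩ := Sylow.exists_subgroup_card_pow_prime (G := Gal(E/R⟮i⟯)) 2 (n := l)
      (by rw [IsGalois.card_aut_eq_finrank, hk]; exact pow_dvd_pow _ (Nat.le_succ l))
    have h5 := finrank_mul_finrank R⟮i⟯ (fixedField H') E
    rw [finrank_fixedField_eq_card, hH', hk, pow_succ, mul_comm] at h5
    exact finrank_ne_two_of_forall_isSquare hsq (Nat.eq_of_mul_eq_mul_left (by positivity) h5)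
  have hint : IsIntegral R i := .of_finite R i
  rw [hk, hk0, pow_zero, mul_one, adjoin.finrank hint] at h4
  rw [← h4]
  have hdvd : minpoly R i ∣ X ^ 2 + 1 := minpoly.dvd R i (by simp [hi])
  have hd : (X ^ 2 + 1 : R[X]).natDegree = 2 := by compute_degree!
  rw [← hd]
  exact natDegree_le_of_dvd hdvd (by
    intro h
    simp [h] at hd)

theorem IsRealClosed.natDegree_le_two_of_isSplittingField {E : Type*} [Field E] [Algebra R E]
    {p : R[X]} (hp : Irreducible p) [IsSplittingField R E (p * (X ^ 2 + 1))] :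
    p.natDegree ≤ 2 := by
  have := IsSplittingField.finiteDimensional E (p * (X ^ 2 + 1))
  have := Normal.of_isSplittingField (E := E) (p * (X ^ 2 + 1))
  have : IsGalois R E := ⟨⟩
  have hdeg : (X ^ 2 + 1 : R[X]).degree = 2 := by compute_degree!
  have hX : (X ^ 2 + 1 : R[X]) ≠ 0 := by
    intro h
    simp [h] at hdeg
  have hmap := Polynomial.map_ne_zero (f := algebraMap R E) (mul_ne_zero hp.ne_zero hX)
  have hsplit := IsSplittingField.splits E (p * (X ^ 2 + 1))
  have h1 := hsplit.of_dvd hmap (map_dvd _ (dvd_mul_right _ _))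
  have h2 := hsplit.of_dvd hmap (map_dvd _ (dvd_mul_left _ _))
  obtain ⟨α, hα⟩ := h1.exists_eval_eq_zero (by rw [degree_map]; exact hp.degree_pos.ne')
  obtain ⟨i, hi⟩ := h2.exists_eval_eq_zero (by rw [degree_map, hdeg]; norm_num)
  have hE : finrank R E ≤ 2 := finrank_le_two (i := i) (by
    simp only [Polynomial.map_add, Polynomial.map_pow, map_X, Polynomial.map_one, eval_add,
      eval_pow, eval_X, eval_one] at hi
    linear_combination hi)
  rw [eval_map_algebraMap] at hα
  have h3 := minpoly.eq_of_irreducible hp hα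
  have h4 := (minpoly.natDegree_le (A := R) α).trans hE
  rwa [← h3, natDegree_mul_C (inv_ne_zero (leadingCoeff_ne_zero.2 hp.ne_zero))] at h4

theorem IsRealClosed.natDegree_le_two {p : R[X]} (hp : Irreducible p) : p.natDegree ≤ 2 :=
  natDegree_le_two_of_isSplittingField (E := (p * (X ^ 2 + 1)).SplittingField) hp

/-- The quadratic case is obtained by completing the square. -/
theorem IsRealClosed.eq_of_irreducible {p : R[X]} (hp : Irreducible p) :
    ∃ c : R, c ≠ 0 ∧ ((∃ r, p = C c * (X - C r)) ∨
      ∃ b d : R, 0 < d ∧ p = C c * ((X - C b) ^ 2 + C d)) := by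
  have hle := natDegree_le_two hp
  have hpos := hp.natDegree_pos
  obtain h | h : p.natDegree = 1 ∨ p.natDegree = 2 := by omega
  · obtain ⟨a, ha, b, rfl⟩ := natDegree_eq_one.1 h
    refine ⟨a, ha, .inl ⟨-b / a, ?_⟩⟩
    rw [mul_sub, ← C_mul, mul_div_cancel₀ _ ha, C_neg, sub_neg_eq_add]
  · have hroot (x : R) : ¬ p.IsRoot x := fun hx => by
      have : p.natDegree = 1 := natDegree_eq_of_degree_eq_some
        (degree_eq_one_of_irreducible_of_root hp hx)
      omega
    obtain ⟨a, ha, b, c, rfl⟩ : ∃ a, a ≠ 0 ∧ ∃ b c, p = C a * X ^ 2 + C b * X + C c :=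
      ⟨p.coeff 2, by rw [← h, coeff_natDegree]; exact leadingCoeff_ne_zero.2 hp.ne_zero,
        p.coeff 1, p.coeff 0, eq_quadratic_of_degree_le_two (degree_le_of_natDegree_le hle)⟩
    refine ⟨a, ha, .inr ⟨-b / (2 * a), c / a - (b / (2 * a)) ^ 2, ?_, ?_⟩⟩
    · by_contra! hd
      obtain ⟨y, -, hy⟩ := exists_sq_eq (neg_nonneg.2 hd)
      apply hroot (y - b / (2 * a))
      simp only [IsRoot, eval_add, eval_mul, eval_C, eval_pow, eval_X]
      have : a * (y ^ 2 + (c / a - (b / (2 * a)) ^ 2)) = 0 := by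
        rw [hy]
        ring
      rw [← this]
      field_simp
      ring
    · have h1 : C b = C a * (2 * C (b / (2 * a))) := by
        rw [← C_ofNat, ← C_mul, ← C_mul]
        congr 1
        field_simp
      have h2 : C c = C a * C (c / a) := by
        rw [← C_mul, mul_div_cancel₀ _ ha]
      rw [h1, h2, neg_div, C_neg, C_sub, C_pow]
      ring

/-- A nonzero polynomial over a real closed field is a product of constants, linear polynomials and
quadratic polynomials without roots. -/
theorem IsRealClosed.polynomial_induction {motive : R[X] → Prop}
    (const : ∀ c : R, c ≠ 0 → motive (C c)) (linear : ∀ r : R, motive (X - C r))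
    (quadratic : ∀ b d : R, 0 < d → motive ((X - C b) ^ 2 + C d))
    (mul : ∀ p q : R[X], motive p → motive q → motive (p * q)) (p : R[X]) (hp : p ≠ 0) :
    motive p := by
  induction p using WfDvdMonoid.induction_on_irreducible with
  | zero => exact absurd rfl hp
  | unit u hu =>
    obtain ⟨c, hc, rfl⟩ := isUnit_iff.1 hu
    exact const c hc.ne_zero
  | mul a i ha hi ih =>
    refine mul _ _ ?_ (ih ha)
    obtain ⟨c, hc, ⟨r, rfl⟩ | ⟨b, d, hd, rfl⟩⟩ := eq_of_irreducible hi
    · exact mul _ _ (const c hc) (linear r)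
    · exact mul _ _ (const c hc) (quadratic b d hd)

end RealClosed

/-! ### Ordered fields and their orders -/

namespace FieldOrder

variable {K : Type*} [Field K]

/-- The order of an ordered field. -/
def ofLinearOrder (K : Type*) [Field K] [LinearOrder K] [IsStrictOrderedRing K] : FieldOrder K :=
  let T : RingPreordering K := RingPreordering.mk' {a | 0 ≤ a} add_nonneg mul_nonneg mul_self_nonneg
    (by simp)
  ⟨T, T.isOrdering_iff.2 fun a b hab => by
    by_contra! h
    have ha : a < 0 := not_le.1 h.1
    have hb : b < 0 := not_le.1 h.2
    have : 0 ≤ -(a * b) := hab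
    linarith [mul_pos_of_neg_of_neg ha hb]⟩

/-- The field `K` as an ordered field, with the order `P`. -/
def Ordered (_P : FieldOrder K) : Type _ := K

namespace Ordered

variable (P : FieldOrder K)

instance : Field P.Ordered := inferInstanceAs (Field K)

noncomputable instance : LinearOrder P.Ordered := P.toLinearOrder

instance : IsStrictOrderedRing P.Ordered :=
  have : IsOrderedRing P.Ordered := P.toLinearOrder_isOrderedRing
  IsOrderedRing.toIsStrictOrderedRing _

end Ordered

/-- The identity map from `K` to `K` with the order `P`. -/
def toOrdered (P : FieldOrder K) : K ≃+* P.Ordered := RingEquiv.refl K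

theorem toOrdered_nonneg {P : FieldOrder K} {a : K} : 0 ≤ P.toOrdered a ↔ a ∈ P.1 := by
  have h : 0 ≤ P.toOrdered a ↔ a - 0 ∈ P.1 := Iff.rfl
  rwa [sub_zero] at h

end FieldOrder

/-! ### Extending orders of the rational function field -/

section Extend

open Polynomial Filter

section CutFilter

variable {R L : Type*} [LinearOrder R] [LinearOrder L]

/-- The filter of the sets of all `r : R` close to the element `x` of an ordered extension of `R`.
It is generated by the sets of the elements lying on the same side of a given `e : R` as `x`. -/
def cutFilter (f : R → L) (x : L) : Filter R :=
  ⨅ e : R, 𝓟 {r | (f e < x → e < r) ∧ (x < f e → r < e)}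

theorem eventually_gt_cutFilter {f : R → L} {x : L} {e : R} (h : f e < x) :
    ∀ᶠ r in cutFilter f x, e < r :=
  mem_of_superset (mem_iInf_of_mem e (mem_principal_self _)) fun _ hr => hr.1 h

theorem eventually_lt_cutFilter {f : R → L} {x : L} {e : R} (h : x < f e) :
    ∀ᶠ r in cutFilter f x, r < e :=
  mem_of_superset (mem_iInf_of_mem e (mem_principal_self _)) fun _ hr => hr.2 h

theorem cutFilter_le_cofinite {f : R → L} {x : L} (h : ∀ e, f e ≠ x) :
    cutFilter f x ≤ cofinite := le_cofinite_iff_eventually_ne.2 fun e => by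
  rcases (h e).lt_or_gt with h | h
  · exact (eventually_gt_cutFilter h).mono fun _ => ne_of_gt
  · exact (eventually_lt_cutFilter h).mono fun _ => ne_of_lt

theorem cutFilter_neBot [DenselyOrdered R] [NoMinOrder R] [NoMaxOrder R] [Nonempty R] {f : R → L}
    (hf : StrictMono f) {x : L} : (cutFilter f x).NeBot := by
  refine neBot_iff.2 fun h => ?_
  rw [← empty_mem_iff_bot, cutFilter, mem_iInf_finite] at h
  obtain ⟨t, ht⟩ := h
  obtain ⟨m, hm1, hm2⟩ := Order.exists_between_finsets (t.filter fun e => f e < x)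
    (t.filter fun e => x < f e) (fun a ha b hb =>
      hf.lt_iff_lt.1 ((Finset.mem_filter.1 ha).2.trans (Finset.mem_filter.1 hb).2))
  rw [iInf_principal_finset, mem_principal] at ht
  refine ht (a := m) (Set.mem_iInter₂.2 fun e he => ⟨fun h => ?_, fun h => ?_⟩)
  · exact hm1 e (Finset.mem_filter.2 ⟨he, h⟩)
  · exact hm2 e (Finset.mem_filter.2 ⟨he, h⟩)

end CutFilter

variable {R L : Type*} [Field R] [LinearOrder R] [IsStrictOrderedRing R] [IsRealClosed R]
  [Field L] [LinearOrder L] [IsStrictOrderedRing L]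

theorem RingHom.strictMono_of_forall_isSquare {F L : Type*} [Field F] [LinearOrder F]
    [IsStrictOrderedRing F] [Field L] [LinearOrder L] [IsStrictOrderedRing L]
    (hF : ∀ x : F, 0 ≤ x → IsSquare x) (f : F →+* L) : StrictMono f := fun a b hab => by
  obtain ⟨y, hy⟩ := hF _ (sub_nonneg.2 hab.le)
  have h1 : f b - f a = f y * f y := by rw [← map_sub, hy, map_mul]
  have h2 : f b - f a ≠ 0 := by
    rw [← map_sub]
    exact (map_ne_zero f).2 (sub_pos.2 hab).ne'
  have h3 : 0 ≤ f b - f a := h1 ▸ mul_self_nonneg _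
  exact sub_pos.1 (h3.lt_of_ne' h2)

theorem IsRealClosed.strictMono_ringHom (f : R →+* L) : StrictMono f :=
  f.strictMono_of_forall_isSquare fun _ => IsRealClosed.nonneg_iff_isSquare.1

/-- In an order of `R(X)`, a polynomial has the sign which its values have close to `X`. -/
theorem IsRealClosed.eventually_sign_eq (f : R[X] →+* L) (hf : Function.Injective f) (p : R[X])
    (hp : p ≠ 0) :
    (0 < f p ∧ ∀ᶠ r in cutFilter (f.comp C) (f X), 0 < p.eval r) ∨
      (f p < 0 ∧ ∀ᶠ r in cutFilter (f.comp C) (f X), p.eval r < 0) := by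
  have hmono := strictMono_ringHom (f.comp C)
  refine polynomial_induction (motive := fun p =>
    (0 < f p ∧ ∀ᶠ r in cutFilter (f.comp C) (f X), 0 < p.eval r) ∨
      (f p < 0 ∧ ∀ᶠ r in cutFilter (f.comp C) (f X), p.eval r < 0)) ?_ ?_ ?_ ?_ p hp
  · intro c hc
    rcases hc.lt_or_gt with h | h
    · exact .inr ⟨by simpa using hmono h, by simp [h]⟩
    · exact .inl ⟨by simpa using hmono h, by simp [h]⟩
  · intro e
    have hne : (f.comp C) e ≠ f X := fun h => X_ne_C e (hf h).symm
    rcases hne.lt_or_gt with h | h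
    · refine .inl ⟨by simpa using h, (eventually_gt_cutFilter h).mono fun r hr => ?_⟩
      simpa using hr
    · refine .inr ⟨by simpa using h, (eventually_lt_cutFilter h).mono fun r hr => ?_⟩
      simpa using hr
  · intro b d hd
    have h : 0 < f (C d) := by simpa using hmono hd
    refine .inl ⟨?_, Eventually.of_forall fun r => ?_⟩
    · rw [map_add, map_pow]
      positivity
    · simp only [eval_add, eval_pow, eval_sub, eval_X, eval_C]
      positivity
  · rintro p q (⟨hp, hp'⟩ | ⟨hp, hp'⟩) (⟨hq, hq'⟩ | ⟨hq, hq'⟩)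
    · refine .inl ⟨by rw [map_mul]; exact mul_pos hp hq, ?_⟩
      filter_upwards [hp', hq'] with r h1 h2
      rw [eval_mul]
      exact mul_pos h1 h2
    · refine .inr ⟨by rw [map_mul]; exact mul_neg_of_pos_of_neg hp hq, ?_⟩
      filter_upwards [hp', hq'] with r h1 h2
      rw [eval_mul]
      exact mul_neg_of_pos_of_neg h1 h2
    · refine .inr ⟨by rw [map_mul]; exact mul_neg_of_neg_of_pos hp hq, ?_⟩
      filter_upwards [hp', hq'] with r h1 h2
      rw [eval_mul]
      exact mul_neg_of_neg_of_pos h1 h2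
    · refine .inl ⟨by rw [map_mul]; exact mul_pos_of_neg_of_neg hp hq, ?_⟩
      filter_upwards [hp', hq'] with r h1 h2
      rw [eval_mul]
      exact mul_pos_of_neg_of_neg h1 h2

/-- The germ of the function `r ↦ p(r)` along an ultrafilter on `R`. -/
noncomputable def polynomialGerm {R S : Type*} [CommRing R] [CommRing S] [Algebra R S]
    (U : Ultrafilter R) : S[X] →+* Germ (U : Filter R) S :=
  (Germ.coeRingHom (U : Filter R)).comp
    (RingHom.pi fun r : R => evalRingHom (algebraMap R S r))

theorem polynomialGerm_apply {R S : Type*} [CommRing R] [CommRing S] [Algebra R S]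
    (U : Ultrafilter R) (p : S[X]) :
    polynomialGerm U p = ((fun r : R => p.eval (algebraMap R S r) : R → S) :
      Germ (U : Filter R) S) := rfl

theorem polynomialGerm_injective {R S : Type*} [Field R] [Field S] [Algebra R S]
    {U : Ultrafilter R} (hU : (U : Filter R) ≤ cofinite) :
    Function.Injective (polynomialGerm (S := S) U) := by
  refine (injective_iff_map_eq_zero _).2 fun p hp => ?_
  by_contra hp0
  rw [polynomialGerm_apply] at hp
  have h1 : ∀ᶠ r in (U : Filter R), p.eval (algebraMap R S r) = 0 := Germ.coe_eq.1 hp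
  have h2 : {r | p.eval (algebraMap R S r) = 0}.Finite := by
    refine (p.rootSet_finite S |>.preimage (algebraMap R S).injective.injOn).subset fun r hr => ?_
    simpa [mem_rootSet, hp0] using hr
  obtain ⟨r, hr1, hr2⟩ := (h1.and (hU h2.compl_mem_cofinite)).exists
  exact hr2 hr1

/-- Every order of `R(X)` extends to `S(X)`: a rational function is declared to be nonnegative if
its values at almost all elements of `R` close to `X` are. -/
theorem FieldOrder.comap_ratFuncInclusion_surjective {S : Type*} [Field S] [LinearOrder S]
    [IsStrictOrderedRing S] [Algebra R S] (hS : StrictMono (algebraMap R S)) :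
    Function.Surjective (FieldOrder.comap (ratFuncInclusion R S)) := fun P => by
  let f : R[X] →+* P.Ordered := P.toOrdered.toRingHom.comp (algebraMap R[X] (RatFunc R))
  have hf : Function.Injective f :=
    P.toOrdered.injective.comp (RatFunc.algebraMap_injective R)
  have := cutFilter_neBot (IsRealClosed.strictMono_ringHom (f.comp C)) (x := f X)
  let U := Ultrafilter.of (cutFilter (f.comp C) (f X))
  have hU : (U : Filter R) ≤ cutFilter (f.comp C) (f X) := Ultrafilter.of_le _
  have hU' := hU.trans (cutFilter_le_cofinite fun e h => X_ne_C e (hf h).symm)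
  have hinj := polynomialGerm_injective (S := S) hU'
  let g : RatFunc S →+* Germ (U : Filter R) S := RatFunc.liftRingHom (polynomialGerm U)
    (nonZeroDivisors_le_comap_nonZeroDivisors_of_injective _ hinj)
  refine ⟨(ofLinearOrder (Germ (U : Filter R) S)).comap g, (ext_of_mem fun a ha => ?_).symm⟩
  change 0 ≤ g (ratFuncInclusion R S a)
  induction a using RatFunc.induction_on with
  | f p q hq =>
  rw [ratFuncInclusion, RatFunc.coe_mapRingHom_eq_coe_map, RatFunc.map_apply_div,
    RatFunc.liftRingHom_apply_div]
  have hq0 : algebraMap R[X] (RatFunc R) q ≠ 0 := RatFunc.algebraMap_ne_zero hq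
  have hpq : 0 ≤ f (p * q) := by
    change 0 ≤ P.toOrdered (algebraMap R[X] (RatFunc R) (p * q))
    rw [toOrdered_nonneg]
    have := mul_mem ha (P.1.mul_self_mem (algebraMap R[X] (RatFunc R) q))
    rw [map_mul]
    convert this using 1
    field_simp
  have hpq' : 0 ≤ polynomialGerm (S := S) U ((p * q).map (algebraMap R S)) := by
    rcases eq_or_ne (p * q) 0 with h0 | h0
    · simp [h0]
    rcases IsRealClosed.eventually_sign_eq f hf _ h0 with h | h
    · rw [polynomialGerm_apply]
      refine Germ.coe_le.2 ?_
      filter_upwards [hU h.2] with r hr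
      rw [eval_map_algebraMap, aeval_algebraMap_apply]
      simpa using (hS hr).le
    · exact absurd hpq h.1.not_ge
  have hq' : polynomialGerm (S := S) U (q.map (algebraMap R S)) ≠ 0 :=
    (map_ne_zero_iff _ hinj).2 (Polynomial.map_ne_zero hq)
  rw [Polynomial.map_mul, map_mul] at hpq'
  have := div_nonneg hpq' (mul_self_nonneg (polynomialGerm (S := S) U (q.map (algebraMap R S))))
  rwa [mul_div_mul_right _ _ hq'] at this

end Extend

/-! ### Completeness of a continuous closure -/

section ContinuousClosure

variable {R S : Type*} [Field R] [LinearOrder R] [Field S] [LinearOrder S]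

/-- In a continuous closed field, two sets which come arbitrarily close to each other are separated
by an element. -/
theorem IsContinuousClosed.exists_between (hS : IsContinuousClosed S) {A B : Set S}
    (hAB : ∀ a ∈ A, ∀ b ∈ B, a ≤ b) (hc : ∀ c : S, 0 < c → ∃ a ∈ A, ∃ b ∈ B, b - a < c) :
    ∃ s, (∀ a ∈ A, a ≤ s) ∧ ∀ b ∈ B, s ≤ b := by
  by_cases h : ∃ x ∈ A, x ∈ B
  · obtain ⟨x, hA, hB⟩ := h
    exact ⟨x, fun a ha => hAB a ha x hB, hAB x hA⟩
  · push Not at h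
    have hB (b : S) (hb : b ∈ B) : ¬ ∃ a ∈ A, b ≤ a := by
      rintro ⟨a, ha, hba⟩
      obtain rfl := hba.antisymm (hAB a ha b hb)
      exact h b ha hb
    have hcut : IsNormalCut {x | ∃ a ∈ A, x ≤ a} {x | ∃ a ∈ A, x ≤ a}ᶜ := by
      refine ⟨⟨Set.union_compl_self _, ?_⟩, fun c hc' => ?_⟩
      · rintro x ⟨a, ha, hxa⟩ y hy
        refine hxa.trans_lt (lt_of_not_ge fun hya => hy ⟨a, ha, hya⟩)
      · obtain ⟨a, ha, b, hb, hab⟩ := hc c hc'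
        exact ⟨a, ⟨a, ha, le_rfl⟩, b, hB b hb, hab⟩
    obtain ⟨hcut', ⟨m, hm⟩ | ⟨m, hm⟩⟩ := hS _ _ hcut
    · exact ⟨m, fun a ha => hm.2 ⟨a, ha, le_rfl⟩, fun b hb => (hcut'.lt m hm.1 b (hB b hb)).le⟩
    · exact ⟨m, fun a ha => (hcut'.lt a ⟨a, ha, le_rfl⟩ m hm.1).le, fun b hb => hm.2 (hB b hb)⟩

variable [Algebra R S] [IsStrictOrderedRing S]

theorem IsContinuousClosure.exists_abs_sub_lt (hS : IsContinuousClosure R S) (s : S) {ε : S}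
    (hε : 0 < ε) : ∃ r : R, |algebraMap R S r - s| < ε := by
  obtain ⟨r, h1, h2⟩ := hS.dense (s - ε) (s + ε) (by linarith)
  exact ⟨r, abs_lt.2 ⟨by linarith, by linarith⟩⟩

/-- The square roots of elements of `R` on both sides of `x` come arbitrarily close to each
other, so that they determine a square root of `x`. -/
theorem IsContinuousClosure.isSquare_of_nonneg [IsStrictOrderedRing R] [IsRealClosed R]
    (hS : IsContinuousClosure R S) (x : S) (hx : 0 ≤ x) : IsSquare x := by
  rcases hx.eq_or_lt with rfl | hx
  · exact IsSquare.zero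
  have hsqrt (r : R) (hr : 0 < algebraMap R S r) :
      ∃ t : S, 0 ≤ t ∧ t ^ 2 = algebraMap R S r := by
    have hr : 0 < r := by rwa [← map_zero (algebraMap R S), hS.strictMono.lt_iff_lt] at hr
    obtain ⟨t, ht0, ht⟩ := IsRealClosed.exists_sq_eq hr.le
    refine ⟨algebraMap R S t, ?_, by rw [← ht, map_pow]⟩
    simpa using hS.strictMono.monotone ht0
  -- On `[t², ∞)` the slopes of the square root are at most `1 / (2 t)`.
  obtain ⟨m, hm0, hmx⟩ := hS.dense 0 x hx
  obtain ⟨t, ht0, ht⟩ := hsqrt m hm0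
  have ht0 : 0 < t := ht0.lt_of_ne (by
    rintro rfl
    simp [← ht] at hm0)
  obtain ⟨s, hs1, hs2⟩ := hS.continuousClosed.exists_between
    (A := {s | 0 ≤ s ∧ s ^ 2 ≤ x}) (B := {s | 0 ≤ s ∧ x ≤ s ^ 2})
    (fun a ha b hb => abs_le_of_sq_le_sq' (ha.2.trans hb.2) hb.1 |>.2) (fun c hc => by
      obtain ⟨r₁, h1, h2⟩ := hS.dense (max (algebraMap R S m) (x - c * t)) x
        (max_lt hmx (by nlinarith))
      obtain ⟨r₂, h3, h4⟩ := hS.dense x (x + c * t) (by nlinarith)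
      obtain ⟨h5, h6⟩ := max_lt_iff.1 h1
      obtain ⟨a, ha0, ha⟩ := hsqrt r₁ (hm0.trans h5)
      obtain ⟨b, hb0, hb⟩ := hsqrt r₂ (hx.trans h3)
      refine ⟨a, ⟨ha0, ha ▸ h2.le⟩, b, ⟨hb0, hb ▸ h3.le⟩, ?_⟩
      -- `(b - a) (b + a) < 2 c t` and both `a` and `b` are at least `t`.
      have hta : t ≤ a := (abs_le_of_sq_le_sq' (by rw [ht, ha]; exact h5.le) ha0).2
      have htb : t ≤ b := (abs_le_of_sq_le_sq' (by rw [ht, hb]; linarith) hb0).2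
      by_contra! hba
      have h7 : c * (2 * t) ≤ (b - a) * (b + a) :=
        mul_le_mul hba (by linarith) (by linarith) (by linarith)
      have h8 : (b - a) * (b + a) = algebraMap R S r₂ - algebraMap R S r₁ := by
        rw [← ha, ← hb]
        ring
      rw [h8] at h7
      linarith)
  have hs0 : 0 < s := ht0.trans_le (hs1 t ⟨ht0.le, ht ▸ hmx.le⟩)
  have h1 : ¬ s ^ 2 < x := fun h => by
    obtain ⟨r, h1, h2⟩ := hS.dense _ _ h
    obtain ⟨u, hu0, hu⟩ := hsqrt r ((sq_nonneg s).trans_lt h1)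
    have := pow_le_pow_left₀ hu0 (hs1 u ⟨hu0, hu ▸ h2.le⟩) 2
    rw [hu] at this
    exact this.not_gt h1
  have h2 : ¬ x < s ^ 2 := fun h => by
    obtain ⟨r, h1, h2⟩ := hS.dense _ _ h
    obtain ⟨u, hu0, hu⟩ := hsqrt r (hx.trans h1)
    have := pow_le_pow_left₀ hs0.le (hs2 u ⟨hu0, hu ▸ h1.le⟩) 2
    rw [hu] at this
    exact this.not_gt h2
  exact ⟨s, by rw [← sq]; exact le_antisymm (not_lt.1 h1) (not_lt.1 h2)⟩

end ContinuousClosure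

/-! ### Polynomials in an element which is infinitesimally close to no element of the base field -/

section Generic

open Polynomial

theorem RingHom.abs_map {S L : Type*} [Field S] [LinearOrder S] [IsStrictOrderedRing S]
    [Field L] [LinearOrder L] [IsStrictOrderedRing L] {f : S →+* L} (hf : StrictMono f) (s : S) :
    |f s| = f |s| := by
  rcases le_total 0 s with h | h
  · rw [abs_of_nonneg h, abs_of_nonneg (by simpa using hf.monotone h)]
  · rw [abs_of_nonpos h, abs_of_nonpos (by simpa using hf.monotone h), map_neg]

/-- If `X` has distance at least `d` from all elements of a real closed field `R`, then the absolute
value of a polynomial over `R` is bounded below, because the polynomial is a product of linear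
factors and of quadratic factors `(X - b)² + c` with `c > 0`. -/
theorem IsRealClosed.le_abs_map {R L : Type*} [Field R] [LinearOrder R] [IsStrictOrderedRing R]
    [IsRealClosed R] [Field L] [LinearOrder L] [IsStrictOrderedRing L] (f : R[X] →+* L) {d : L}
    (hd0 : 0 ≤ d) (hd : ∀ r, d ≤ |f X - f (C r)|) (p : R[X]) (hp : p ≠ 0) :
    |f (C p.leadingCoeff)| * d ^ p.natDegree ≤ |f p| := by
  suffices h : p ≠ 0 ∧ |f (C p.leadingCoeff)| * d ^ p.natDegree ≤ |f p| from h.2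
  have hmono := strictMono_ringHom (f.comp C)
  refine polynomial_induction
    (motive := fun p => p ≠ 0 ∧ |f (C p.leadingCoeff)| * d ^ p.natDegree ≤ |f p|) ?_ ?_ ?_ ?_ p hp
  · exact fun c hc => ⟨C_ne_zero.2 hc, by simp⟩
  · exact fun r => ⟨X_sub_C_ne_zero r, by simpa using hd r⟩
  · intro b c hc
    have hm : ((X - C b) ^ 2 + C c).Monic := by monicity!
    have hdeg : ((X - C b) ^ 2 + C c).natDegree = 2 := by
      compute_degree!
    refine ⟨hm.ne_zero, ?_⟩
    have hfc : 0 < f (C c) := by simpa using hmono hc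
    rw [hm.leadingCoeff, hdeg, C_1, map_one, abs_one, one_mul, map_add, map_pow, map_sub]
    have h1 : d ^ 2 ≤ (f X - f (C b)) ^ 2 := by
      rw [← sq_abs (f X - _)]
      exact pow_le_pow_left₀ hd0 (hd b) 2
    exact (h1.trans (by linarith)).trans (le_abs_self _)
  · rintro p q ⟨hp0, hp⟩ ⟨hq0, hq⟩
    refine ⟨mul_ne_zero hp0 hq0, ?_⟩
    rw [leadingCoeff_mul, natDegree_mul hp0 hq0, C_mul, map_mul, map_mul, abs_mul, abs_mul, pow_add]
    calc _ = (|f (C p.leadingCoeff)| * d ^ p.natDegree) *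
          (|f (C q.leadingCoeff)| * d ^ q.natDegree) := by ring
      _ ≤ _ := by gcongr

variable {R S L : Type*} [Field S] [LinearOrder S] [IsStrictOrderedRing S]
  [Field L] [LinearOrder L] [IsStrictOrderedRing L]

theorem abs_map_polynomial_le {f : S[X] →+* L} (hf : StrictMono (f.comp C)) {p : S[X]} {n : ℕ}
    (hn : p.natDegree ≤ n) {ε : S} (hε : ∀ i, |p.coeff i| ≤ ε) :
    |f p| ≤ f (C ((n + 1) * ε)) * (1 + |f X|) ^ n := by
  have hN : 1 ≤ 1 + |f X| := by linarith [abs_nonneg (f X)]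
  have hε0 : 0 ≤ ε := (abs_nonneg _).trans (hε 0)
  rw [p.as_sum_range_C_mul_X_pow' (Nat.lt_succ_of_le hn), map_sum]
  refine (Finset.abs_sum_le_sum_abs _ _).trans ?_
  have h (i : ℕ) (hi : i ∈ Finset.range n.succ) :
      |f (C (p.coeff i) * X ^ i)| ≤ f (C ε) * (1 + |f X|) ^ n := by
    rw [map_mul, map_pow, abs_mul, abs_pow]
    have h1 : |f (C (p.coeff i))| ≤ f (C ε) := by
      have := RingHom.abs_map hf (p.coeff i)
      rw [RingHom.comp_apply] at this
      rw [this]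
      exact hf.monotone (hε i)
    have h2 : |f X| ^ i ≤ (1 + |f X|) ^ n :=
      (pow_le_pow_left₀ (abs_nonneg _) (by linarith) i).trans
        (pow_le_pow_right₀ hN (Nat.lt_succ_iff.1 (Finset.mem_range.1 hi)))
    exact mul_le_mul h1 h2 (by positivity) ((abs_nonneg _).trans h1)
  refine (Finset.sum_le_card_nsmul _ _ _ h).trans (le_of_eq ?_)
  rw [Finset.card_range, nsmul_eq_mul]
  simp only [Nat.succ_eq_add_one, map_mul, map_add, map_natCast, map_one, Nat.cast_add,
    Nat.cast_one]
  ring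

variable [Field R] [LinearOrder R] [Algebra R S]

theorem IsContinuousClosure.exists_polynomial_approx (hS : IsContinuousClosure R S) (p : S[X])
    {ε : S} (hε : 0 < ε) : ∃ q : R[X], q.natDegree ≤ p.natDegree ∧
      ∀ i, |(q.map (algebraMap R S) - p).coeff i| ≤ ε := by
  choose c hc using fun s => hS.exists_abs_sub_lt s hε
  refine ⟨∑ i ∈ Finset.range (p.natDegree + 1), monomial i (c (p.coeff i)), ?_, fun i => ?_⟩
  · refine natDegree_sum_le_of_forall_le _ _ fun i hi => (natDegree_monomial_le _).trans ?_
    exact Nat.lt_succ_iff.1 (Finset.mem_range.1 hi)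
  · rw [coeff_sub, coeff_map, finsetSum_coeff]
    simp only [coeff_monomial, Finset.sum_ite_eq', Finset.mem_range]
    split_ifs with h
    · exact (hc _).le
    · rw [coeff_eq_zero_of_natDegree_lt (by omega)]
      simpa using hε.le

/-- A dichotomy for an element `X` of an ordered extension of `S`: it keeps its distance from all
elements of `R`, or it is infinitesimally close to an element of `S`. In the second case `X`
determines a normal cut of `S`, which is principal. -/
theorem IsContinuousClosure.exists_forall_le_or_exists_forall_lt (hS : IsContinuousClosure R S)
    {f : S →+* L} (hf : StrictMono f) (x : L) :
    (∃ δ : S, 0 < δ ∧ ∀ r : R, f δ * (1 + |x|) ≤ |x - f (algebraMap R S r)|) ∨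
      ∃ a : S, ∀ δ : S, 0 < δ → |x - f a| < f δ := by
  by_contra! hcon
  obtain ⟨h, hcon⟩ := hcon
  obtain ⟨r₀, hr₀⟩ := h (1 / 2) (by norm_num)
  have hhalf : f (1 / 2) = 1 / 2 := by rw [map_div₀, map_one, map_ofNat]
  rw [hhalf] at hr₀
  set M : S := 2 * |algebraMap R S r₀| + 2
  have hM0 : 0 < M := by positivity
  have hM : 1 + |x| ≤ f M := by
    have h1 := abs_sub_abs_le_abs_sub x (f (algebraMap R S r₀))
    simp only [M, map_add, map_mul, map_ofNat, ← RingHom.abs_map hf]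
    linarith
  have key (δ : S) (hδ : 0 < δ) : ∃ s : S, |x - f s| < f δ := by
    obtain ⟨r, hr⟩ := h (δ / M) (by positivity)
    refine ⟨_, hr.trans_le ?_⟩
    have h1 : 0 ≤ f (δ / M) := by simpa using hf.monotone (div_pos hδ hM0).le
    refine (mul_le_mul_of_nonneg_left hM h1).trans (le_of_eq ?_)
    rw [← map_mul, div_mul_cancel₀ _ hM0.ne']
  have key' (δ : S) (hδ : 0 < δ) : ∃ s : S, |x - f s| < f δ ∧ f (s - δ) ≤ x ∧ x ≤ f (s + δ) := by
    obtain ⟨s, hs⟩ := key δ hδ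
    obtain ⟨h1, h2⟩ := abs_lt.1 hs
    exact ⟨s, hs, by rw [map_sub]; linarith, by rw [map_add]; linarith⟩
  obtain ⟨a, ha1, ha2⟩ := hS.continuousClosed.exists_between
    (A := {s | f s ≤ x}) (B := {s | x ≤ f s})
    (fun a ha b hb => hf.le_iff_le.1 (le_trans ha hb)) (fun c hc => by
      obtain ⟨s, -, h1, h2⟩ := key' (c / 4) (by positivity)
      exact ⟨_, h1, _, h2, by linarith⟩)
  obtain ⟨δ, hδ, hcon⟩ := hcon a
  obtain ⟨s, h1, h2, h3⟩ := key' (δ / 2) (by positivity)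
  have h4 := ha1 _ h2
  have h5 := ha2 _ h3
  have h6 : |f s - f a| ≤ f (δ / 2) := by
    rw [← map_sub, RingHom.abs_map hf]
    exact hf.monotone (abs_le.2 ⟨by linarith, by linarith⟩)
  have h7 : f δ = f (δ / 2) + f (δ / 2) := by rw [← map_add, add_halves]
  have h8 := abs_sub_le x (f s) (f a)
  linarith

variable [IsStrictOrderedRing R] [IsRealClosed R]

/-- If `X` has distance at least `δ(1 + |X|)` from all elements of `R`, then the
absolute value of a nonzero polynomial of degree `n` over `S` is at least `κ(1 + |X|)ⁿ` for some
positive `κ` in `S`. -/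
theorem IsContinuousClosure.exists_le_abs_map (hS : IsContinuousClosure R S) {f : S[X] →+* L}
    (hf : StrictMono (f.comp C)) {δ : S} (hδ : 0 < δ)
    (h : ∀ r : R, f (C δ) * (1 + |f X|) ≤ |f X - f (C (algebraMap R S r))|) {p : S[X]}
    (hp : p ≠ 0) :
    ∃ κ : S, 0 < κ ∧ f (C κ) * (1 + |f X|) ^ p.natDegree ≤ |f p| := by
  set n := p.natDegree with hn
  set l := |p.leadingCoeff| with hl
  have hl0 : 0 < l := abs_pos.2 (leadingCoeff_ne_zero.2 hp)
  have hN : 0 < 1 + |f X| := by positivity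
  have hn0 : (0 : S) < n + 1 := by positivity
  -- The coefficients are approximated up to an error which does not spoil the leading coefficient.
  let ε := min (l / 2) (l / 4 * δ ^ n / (n + 1))
  obtain ⟨q, hqn, hq⟩ := hS.exists_polynomial_approx p (ε := ε) (by positivity)
  have hlq : l / 2 ≤ |algebraMap R S (q.coeff n)| := by
    have h1 := (hq n).trans (min_le_left _ _)
    rw [coeff_sub, coeff_map] at h1
    have h2 := abs_sub_abs_le_abs_sub (p.coeff n) (algebraMap R S (q.coeff n))
    rw [abs_sub_comm] at h2
    have h3 : |p.coeff n| = l := rfl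
    linarith
  have hq0 : q.coeff n ≠ 0 := by
    intro h0
    rw [h0, map_zero, abs_zero] at hlq
    linarith
  have hqd : q.natDegree = n := hqn.antisymm (le_natDegree_of_ne_zero hq0)
  have h1 := IsRealClosed.le_abs_map (f.comp (mapRingHom (algebraMap R S)))
    (d := f (C δ) * (1 + |f X|))
    (mul_nonneg (by simpa using hf.monotone hδ.le) hN.le)
    (fun r => by simpa using h r) q (by rintro rfl; simp at hq0)
  rw [hqd, leadingCoeff, hqd] at h1
  simp only [RingHom.comp_apply, coe_mapRingHom, map_C] at h1
  have h2 := abs_map_polynomial_le hf (p := q.map (algebraMap R S) - p) (n := n)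
    ((natDegree_sub_le _ _).trans (max_le (natDegree_map_le.trans hqn) le_rfl))
    (fun i => (hq i).trans (min_le_right _ _))
  have h3 : f (C (l / 2)) ≤ |f (C (algebraMap R S (q.coeff n)))| :=
    (hf.monotone hlq).trans (RingHom.abs_map hf _).ge
  have h4 : f (C (l / 2)) * (f (C δ) * (1 + |f X|)) ^ n ≤ |f (q.map (algebraMap R S))| :=
    (mul_le_mul_of_nonneg_right h3 (by
      have : 0 < f (C δ) := by simpa using hf hδ
      positivity)).trans h1
  have h5 : f (C (l / 2)) * (f (C δ) * (1 + |f X|)) ^ n =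
      f (C (l / 4 * δ ^ n)) * (1 + |f X|) ^ n + f (C (l / 4 * δ ^ n)) * (1 + |f X|) ^ n := by
    have : f (C (l / 2)) = f (C (l / 4)) + f (C (l / 4)) := by
      rw [← map_add, ← C_add]
      congr 2
      ring
    rw [this, C_mul, C_pow, map_mul, map_pow, mul_pow]
    ring
  rw [mul_div_cancel₀ _ hn0.ne', map_sub] at h2
  refine ⟨l / 4 * δ ^ n, by positivity, ?_⟩
  have h6 := abs_sub_abs_le_abs_sub (f (q.map (algebraMap R S))) (f p)
  linarith

end Generic

/-! ### Orders with the same real place -/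

namespace FieldOrder

variable {K : Type*} [Field K]

theorem abs_toOrdered_le_natCast {P : FieldOrder K} {a : K} {n : ℕ} :
    |P.toOrdered a| ≤ n ↔ (n : K) + a ∈ P.1 ∧ (n : K) - a ∈ P.1 := by
  rw [abs_le, ← toOrdered_nonneg, ← toOrdered_nonneg, map_add, map_sub, map_natCast,
    ← neg_le_iff_add_nonneg', sub_nonneg]

theorem mem_toRealPlace_of_abs_le {P : FieldOrder K} {a : K} {n : ℕ} (h : |P.toOrdered a| ≤ n) :
    a ∈ P.toRealPlace.valuationSubring := by
  have h1 : |P.toOrdered a| ≤ (n + 1 : ℕ) := h.trans (by exact_mod_cast Nat.le_succ n)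
  obtain ⟨h2, h3⟩ := abs_le.1 h1
  have : P.toOrdered a ∈ (RealPlace.ofOrderedField P.Ordered).valuationSubring :=
    RealPlace.mem_ofOrderedField.2 ⟨(n + 1 : ℕ), by positivity, by
      push_cast at h2 ⊢
      linarith, by
      push_cast at h3 ⊢
      linarith⟩
  exact this

theorem toRealPlace_nonneg {P : FieldOrder K} {a : P.toRealPlace.valuationSubring}
    (h : (a : K) ∈ P.1) : 0 ≤ P.toRealPlace.toRingHom a := by
  have := RealPlace.ofOrderedField_mono (K := P.Ordered) (a := 0) (b := a) (toOrdered_nonneg.2 h)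
  rwa [map_zero] at this

theorem abs_le_two_of_toRealPlace_eq {P Q : FieldOrder K} (h : P.toRealPlace = Q.toRealPlace)
    {a : K} (ha : |P.toOrdered a| ≤ 1) : |Q.toOrdered a| ≤ 2 := by
  rw [← Nat.cast_one] at ha
  obtain ⟨h1, h2⟩ := abs_toOrdered_le_natCast.1 ha
  let a' : P.toRealPlace.valuationSubring := ⟨a, mem_toRealPlace_of_abs_le ha⟩
  have h3 := toRealPlace_nonneg (a := 1 + a') (by simpa using h1)
  have h4 := toRealPlace_nonneg (a := 1 - a') (by simpa using h2)
  have h5 : 0 < P.toRealPlace.toRingHom (2 + a') := by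
    rw [map_add, map_one] at h3
    rw [map_add, map_ofNat]
    linarith
  have h6 : 0 < P.toRealPlace.toRingHom (2 - a') := by
    rw [map_sub, map_one] at h4
    rw [map_sub, map_ofNat]
    linarith
  have key (ξ : RealPlace K) (hξ : ξ = Q.toRealPlace) (b : ξ.valuationSubring)
      (hb : 0 < ξ.toRingHom b) : (b : K) ∈ Q.1 := by
    subst hξ
    exact mem_of_toRealPlace_pos hb
  rw [← Nat.cast_ofNat]
  exact abs_toOrdered_le_natCast.2 ⟨key _ h _ h5, key _ h _ h6⟩

/-- Two orders have the same real place if the elements bounded by `1` in the first are uniformly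
bounded in the second. -/
theorem toRealPlace_eq_of_abs_le {P Q : FieldOrder K}
    (H : ∀ a, |P.toOrdered a| ≤ 1 → |Q.toOrdered a| ≤ 4) : P.toRealPlace = Q.toRealPlace := by
  have : CharZero K := inferInstanceAs (CharZero P.Ordered)
  refine (toRealPlace_eq fun a ha => ?_).symm
  -- Zoom in around a rational number `q` just above the value of `a`.
  obtain ⟨q, hq1, hq2⟩ := exists_rat_btwn
    (show P.toRealPlace.toRingHom a < P.toRealPlace.toRingHom a * (9 / 8) by linarith)
  have hq0 : (0 : ℝ) < q := ha.trans hq1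
  let b : P.toRealPlace.valuationSubring := (a - ⟨(q : K), RealPlace.ratCast_mem _ q⟩) *
    ⟨((8 / q : ℚ) : K), RealPlace.ratCast_mem _ _⟩
  have hb : P.toRealPlace.toRingHom b = (P.toRealPlace.toRingHom a - q) * (8 / q) := by
    rw [map_mul, map_sub, RealPlace.apply_ratCast, RealPlace.apply_ratCast]
    push_cast
    rfl
  have hb1 : P.toRealPlace.toRingHom b < 1 := by
    rw [hb, mul_div_assoc', div_lt_one hq0]
    linarith
  have hb2 : -1 < P.toRealPlace.toRingHom b := by
    rw [hb, mul_div_assoc', lt_div_iff₀ hq0]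
    linarith
  have h1 : ((1 : ℕ) : K) + b ∈ P.1 := by
    have := mem_of_toRealPlace_pos (P := P) (a := 1 + b) (by rw [map_add, map_one]; linarith)
    simpa using this
  have h2 : ((1 : ℕ) : K) - b ∈ P.1 := by
    have := mem_of_toRealPlace_pos (P := P) (a := 1 - b) (by rw [map_sub, map_one]; linarith)
    simpa using this
  have h3 := (abs_le.1 (H b (by simpa using abs_toOrdered_le_natCast.2 ⟨h1, h2⟩))).1
  have h4 : Q.toOrdered (b : K) = (Q.toOrdered a - q) * (8 / q) := by
    have h8 : Q.toOrdered 8 = 8 := map_ofNat _ 8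
    simp [b, h8]
  have hq0' : (0 : Q.Ordered) < q := by exact_mod_cast hq0
  rw [h4, mul_div_assoc', le_div_iff₀ hq0'] at h3
  rw [← toOrdered_nonneg]
  linarith

end FieldOrder

/-! ### Injectivity of the restriction of places -/

section Injective

open Polynomial

theorem ratFuncInclusion_algebraMap {R S : Type*} [Field R] [Field S] [Algebra R S] (p : R[X]) :
    ratFuncInclusion R S (algebraMap R[X] (RatFunc R) p) =
      algebraMap S[X] (RatFunc S) (p.map (algebraMap R S)) := by
  have := RatFunc.map_apply_div (mapRingHom (algebraMap R S))
    (nonZeroDivisors_le_comap_nonZeroDivisors_of_injective _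
      (Polynomial.map_injective _ (algebraMap R S).injective)) p 1
  simpa [ratFuncInclusion, RatFunc.coe_mapRingHom_eq_coe_map] using this

/-- If `X` is infinitesimally close to `a` over `S`, then `p` is so to its value at `a`. -/
theorem abs_map_sub_eval_lt {S L : Type*} [Field S] [LinearOrder S] [IsStrictOrderedRing S]
    [Field L] [LinearOrder L] [IsStrictOrderedRing L]
    {f : S[X] →+* L} (hf : StrictMono (f.comp C)) {a : S}
    (ha : ∀ δ : S, 0 < δ → |f X - f (C a)| < f (C δ)) (p : S[X]) :
    ∀ δ : S, 0 < δ → |f p - f (C (p.eval a))| < f (C δ) := by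
  induction p using Polynomial.induction_on with
  | C c => exact fun δ hδ => by simpa using hf hδ
  | add p q hp hq =>
    intro δ hδ
    have h1 := hp (δ / 2) (by positivity)
    have h2 := hq (δ / 2) (by positivity)
    have h3 : f (C δ) = f (C (δ / 2)) + f (C (δ / 2)) := by rw [← map_add, ← C_add, add_halves]
    rw [eval_add, C_add, map_add, map_add, add_sub_add_comm, h3]
    exact (abs_add_le _ _).trans_lt (add_lt_add h1 h2)
  | monomial n c ih =>
    intro δ hδ
    rw [pow_succ, ← mul_assoc]
    generalize C c * X ^ n = p at ih
    rw [eval_mul, eval_X, C_mul, map_mul, map_mul]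
    let M : S := |a| + 2 + |p.eval a|
    have hM : 0 < M := by positivity
    have h1 := ih (δ / M) (by positivity)
    have h2 := ha (δ / M) (by positivity)
    have h3 := ha 1 one_pos
    have habs (s : S) : |f (C s)| = f (C |s|) := RingHom.abs_map hf s
    have h4 : |f X| ≤ |f (C a)| + 1 := by
      have := abs_sub_abs_le_abs_sub (f X) (f (C a))
      rw [C_1, map_one] at h3
      linarith
    have h5 : f (C δ) = f (C (δ / M)) * (|f (C a)| + 2 + |f (C (p.eval a))|) := by
      have : f (C M) = |f (C a)| + 2 + |f (C (p.eval a))| := by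
        simp only [M, habs, map_add]
        rw [← map_ofNat (f.comp C) 2]
        rfl
      rw [← this, ← map_mul, ← C_mul, div_mul_cancel₀ _ hM.ne']
    have h0 : 0 < f (C (δ / M)) := (abs_nonneg _).trans_lt h1
    calc |f p * f X - f (C (p.eval a)) * f (C a)|
        = |(f p - f (C (p.eval a))) * f X + f (C (p.eval a)) * (f X - f (C a))| := by
          congr 1
          ring
      _ ≤ |f p - f (C (p.eval a))| * |f X| + |f (C (p.eval a))| * |f X - f (C a)| := by
          rw [← abs_mul, ← abs_mul]
          exact abs_add_le _ _
      _ ≤ f (C (δ / M)) * (|f (C a)| + 1) + |f (C (p.eval a))| * f (C (δ / M)) := by gcongr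
      _ < f (C δ) := by
          rw [h5]
          linarith

namespace FieldOrder

section Polynomial

variable {S : Type*} [Field S]

/-- The polynomials over `S` as elements of the field `S(X)` ordered by `P`. -/
noncomputable def polynomialHom (P : FieldOrder (RatFunc S)) : S[X] →+* P.Ordered :=
  P.toOrdered.toRingHom.comp (algebraMap S[X] (RatFunc S))

theorem polynomialHom_apply (P : FieldOrder (RatFunc S)) (p : S[X]) :
    P.polynomialHom p = P.toOrdered (algebraMap S[X] (RatFunc S) p) := rfl

theorem polynomialHom_ne_zero (P : FieldOrder (RatFunc S)) {p : S[X]} (hp : p ≠ 0) :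
    P.polynomialHom p ≠ 0 :=
  P.toOrdered.map_ne_zero_iff.2 (RatFunc.algebraMap_ne_zero hp)

variable {P Q : FieldOrder (RatFunc S)}

/-- The criterion `toRealPlace_eq_of_abs_le` for fractions in lowest terms. -/
theorem toRealPlace_eq_of_polynomial
    (H : ∀ p q : S[X], q ≠ 0 → IsCoprime p q → |P.polynomialHom p| ≤ |P.polynomialHom q| →
      |Q.polynomialHom p| ≤ 4 * |Q.polynomialHom q|) : P.toRealPlace = Q.toRealPlace := by
  refine toRealPlace_eq_of_abs_le fun z hz => ?_
  have h0 := z.denom_ne_zero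
  rw [← RatFunc.num_div_denom z, map_div₀, ← polynomialHom_apply, ← polynomialHom_apply,
    abs_div] at hz ⊢
  rw [div_le_one (abs_pos.2 (P.polynomialHom_ne_zero h0))] at hz
  rw [div_le_iff₀ (abs_pos.2 (Q.polynomialHom_ne_zero h0))]
  exact H _ _ h0 z.isCoprime_num_denom hz

theorem abs_polynomialHom_map_le {R : Type*} [Field R] [Algebra R S]
    (h : P.toRealPlace.comap (ratFuncInclusion R S) = Q.toRealPlace.comap (ratFuncInclusion R S))
    {p q : R[X]} (hq : q ≠ 0)
    (hpq : |P.polynomialHom (p.map (algebraMap R S))| ≤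
      |P.polynomialHom (q.map (algebraMap R S))|) :
    |Q.polynomialHom (p.map (algebraMap R S))| ≤
      2 * |Q.polynomialHom (q.map (algebraMap R S))| := by
  rw [← toRealPlace_comap, ← toRealPlace_comap] at h
  have hq' : q.map (algebraMap R S) ≠ 0 := Polynomial.map_ne_zero hq
  let z : RatFunc R := algebraMap R[X] (RatFunc R) p / algebraMap R[X] (RatFunc R) q
  have hz (O : FieldOrder (RatFunc S)) : O.toOrdered (ratFuncInclusion R S z) =
      O.polynomialHom (p.map (algebraMap R S)) / O.polynomialHom (q.map (algebraMap R S)) := by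
    rw [map_div₀, map_div₀, ratFuncInclusion_algebraMap, ratFuncInclusion_algebraMap]
    rfl
  have habs (O : FieldOrder (RatFunc S)) (n : ℕ) :
      |(O.comap (ratFuncInclusion R S)).toOrdered z| ≤ n ↔
        |O.polynomialHom (p.map (algebraMap R S))| ≤
          n * |O.polynomialHom (q.map (algebraMap R S))| := by
    rw [← div_le_iff₀ (abs_pos.2 (O.polynomialHom_ne_zero hq')), ← abs_div, ← hz,
      abs_toOrdered_le_natCast, abs_toOrdered_le_natCast, mem_comap, mem_comap]
    simp
  have h1 := (habs P 1).2 (by simpa using hpq)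
  have h2 := (habs Q 2).1 (by simpa using abs_le_two_of_toRealPlace_eq h (by simpa using h1))
  simpa using h2

end Polynomial

variable {R S : Type*} [Field R] [LinearOrder R] [IsStrictOrderedRing R] [IsRealClosed R]
  [Field S] [LinearOrder S] [IsStrictOrderedRing S] [Algebra R S] {P Q : FieldOrder (RatFunc S)}

theorem strictMono_polynomialHom (hS : IsContinuousClosure R S) (P : FieldOrder (RatFunc S)) :
    StrictMono (P.polynomialHom.comp C) :=
  RingHom.strictMono_of_forall_isSquare hS.isSquare_of_nonneg _

/-- If `X` is infinitesimally close to `a` in the order `P`, then it is so in each order `Q` whose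
place agrees with that of `P` on `R(X)`: the quotients `(X - r) / ε` with `r` and `ε` in `R`
and `|a - r| < ε` are bounded in both orders. -/
theorem abs_X_sub_lt_of_comap_eq (hS : IsContinuousClosure R S)
    (h : P.toRealPlace.comap (ratFuncInclusion R S) = Q.toRealPlace.comap (ratFuncInclusion R S))
    {a : S}
    (ha : ∀ δ : S, 0 < δ → |P.polynomialHom X - P.polynomialHom (C a)| < P.polynomialHom (C δ))
    (δ : S) (hδ : 0 < δ) :
    |Q.polynomialHom X - Q.polynomialHom (C a)| < Q.polynomialHom (C δ) := by
  obtain ⟨ε, hε0, hε⟩ := hS.dense 0 (δ / 5) (by positivity)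
  obtain ⟨r, hr⟩ := hS.exists_abs_sub_lt a hε0
  have hε0' : ε ≠ 0 := by
    rintro rfl
    simp at hε0
  have hra (O : FieldOrder (RatFunc S)) :
      |O.polynomialHom (C (algebraMap R S r)) - O.polynomialHom (C a)| <
        O.polynomialHom (C (algebraMap R S ε)) := by
    have h1 := RingHom.abs_map (strictMono_polynomialHom hS O) (algebraMap R S r - a)
    rw [map_sub] at h1
    exact h1.trans_lt (strictMono_polynomialHom hS O hr)
  have hpos (O : FieldOrder (RatFunc S)) : 0 < O.polynomialHom (C (algebraMap R S ε)) :=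
    (abs_nonneg _).trans_lt (hra O)
  have htwo (O : FieldOrder (RatFunc S)) :
      |O.polynomialHom ((C (2 * ε)).map (algebraMap R S))| =
        2 * O.polynomialHom (C (algebraMap R S ε)) := by
    rw [map_C, map_mul, C_mul, map_mul, abs_mul, abs_of_pos (hpos O), map_ofNat, C_ofNat,
      map_ofNat, abs_of_pos two_pos]
  have hXr (O : FieldOrder (RatFunc S)) : O.polynomialHom ((X - C r).map (algebraMap R S)) =
      O.polynomialHom X - O.polynomialHom (C (algebraMap R S r)) := by simp
  have h1 := abs_polynomialHom_map_le h (p := X - C r) (q := C (2 * ε))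
    (C_ne_zero.2 (mul_ne_zero two_ne_zero hε0')) (by
      rw [htwo, hXr]
      have h2 := abs_sub_le (P.polynomialHom X) (P.polynomialHom (C a))
        (P.polynomialHom (C (algebraMap R S r)))
      have h3 := hra P
      rw [abs_sub_comm] at h3
      linarith [ha _ hε0])
  rw [htwo, hXr] at h1
  have h2 := abs_sub_le (Q.polynomialHom X) (Q.polynomialHom (C (algebraMap R S r)))
    (Q.polynomialHom (C a))
  have h3 : 5 * Q.polynomialHom (C (algebraMap R S ε)) ≤ Q.polynomialHom (C δ) := by
    have h4 := (strictMono_polynomialHom hS Q).monotone (show 5 * algebraMap R S ε ≤ δ by linarith)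
    rwa [map_mul, map_ofNat] at h4
  linarith [hra Q]

/-- If `X` is infinitesimally close to `a` in two orders, then they have the same place: in both of
them `p` and `q` are infinitesimally close to their values at `a`, not both of which vanish. -/
theorem toRealPlace_eq_of_forall_lt (hS : IsContinuousClosure R S) {a : S}
    (hP : ∀ δ : S, 0 < δ → |P.polynomialHom X - P.polynomialHom (C a)| < P.polynomialHom (C δ))
    (hQ : ∀ δ : S, 0 < δ → |Q.polynomialHom X - Q.polynomialHom (C a)| < Q.polynomialHom (C δ)) :
    P.toRealPlace = Q.toRealPlace := by
  refine toRealPlace_eq_of_polynomial fun p q hq hcop hpq => ?_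
  have habs (O : FieldOrder (RatFunc S)) (s : S) :
      |O.polynomialHom (C s)| = O.polynomialHom (C |s|) :=
    RingHom.abs_map (strictMono_polynomialHom hS O) s
  have hmono (O : FieldOrder (RatFunc S)) {s t : S} :
      O.polynomialHom (C s) < O.polynomialHom (C t) ↔ s < t :=
    (strictMono_polynomialHom hS O).lt_iff_lt
  have hle : |p.eval a| ≤ |q.eval a| := by
    refine le_of_forall_pos_lt_add fun δ hδ => ?_
    have h1 := abs_map_sub_eval_lt (strictMono_polynomialHom hS P) hP p (δ / 2) (by positivity)
    have h2 := abs_map_sub_eval_lt (strictMono_polynomialHom hS P) hP q (δ / 2) (by positivity)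
    have h3 := abs_sub_abs_le_abs_sub (P.polynomialHom (C (p.eval a))) (P.polynomialHom p)
    have h4 := abs_sub_abs_le_abs_sub (P.polynomialHom q) (P.polynomialHom (C (q.eval a)))
    rw [abs_sub_comm _ (P.polynomialHom p)] at h3
    have h5 : P.polynomialHom (C δ) =
        P.polynomialHom (C (δ / 2)) + P.polynomialHom (C (δ / 2)) := by
      rw [← map_add, ← C_add, add_halves]
    rw [← hmono P, C_add, map_add, ← habs, ← habs, h5]
    linarith
  have hqa : 0 < |q.eval a| := by
    refine abs_pos.2 fun h0 => ?_
    rw [h0, abs_zero, abs_nonpos_iff] at hle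
    obtain ⟨u, v, huv⟩ := hcop
    have := congrArg (Polynomial.eval a) huv
    simp [h0, hle] at this
  have h1 := abs_map_sub_eval_lt (strictMono_polynomialHom hS Q) hQ p (|q.eval a| / 2)
    (by positivity)
  have h2 := abs_map_sub_eval_lt (strictMono_polynomialHom hS Q) hQ q (|q.eval a| / 2)
    (by positivity)
  have h3 := abs_sub_abs_le_abs_sub (Q.polynomialHom p) (Q.polynomialHom (C (p.eval a)))
  have h4 := abs_sub_abs_le_abs_sub (Q.polynomialHom (C (q.eval a))) (Q.polynomialHom q)
  rw [abs_sub_comm _ (Q.polynomialHom q), habs] at h4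
  rw [habs] at h3
  have h5 : Q.polynomialHom (C |q.eval a|) =
      Q.polynomialHom (C (|q.eval a| / 2)) + Q.polynomialHom (C (|q.eval a| / 2)) := by
    rw [← map_add, ← C_add, add_halves]
  have h6 : Q.polynomialHom (C |p.eval a|) ≤ Q.polynomialHom (C |q.eval a|) :=
    (strictMono_polynomialHom hS Q).monotone hle
  linarith [abs_nonneg (Q.polynomialHom q)]

/-- If `X` keeps its distance from `R` in the order `P`, then a polynomial over `S` differs little,
relative to its own size, from all polynomials over `R` with nearby coefficients. -/
theorem exists_forall_abs_sub_le (hS : IsContinuousClosure R S) {δ : S} (hδ : 0 < δ)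
    (hP : ∀ r : R, P.polynomialHom (C δ) * (1 + |P.polynomialHom X|) ≤
      |P.polynomialHom X - P.polynomialHom (C (algebraMap R S r))|) {p : S[X]} (hp : p ≠ 0) :
    ∃ ε : S, 0 < ε ∧ ∀ q : R[X], q.natDegree ≤ p.natDegree →
      (∀ i, |(q.map (algebraMap R S) - p).coeff i| ≤ ε) →
        10 * |P.polynomialHom (q.map (algebraMap R S)) - P.polynomialHom p| ≤
          |P.polynomialHom p| := by
  have hmono := strictMono_polynomialHom hS P
  obtain ⟨κ, hκ0, hκ⟩ := hS.exists_le_abs_map hmono hδ hP hp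
  have hn : (0 : S) < p.natDegree + 1 := by positivity
  refine ⟨κ / 10 / (p.natDegree + 1), by positivity, fun q hqp hq => ?_⟩
  have h1 := abs_map_polynomial_le hmono (p := q.map (algebraMap R S) - p) (n := p.natDegree)
    ((natDegree_sub_le _ _).trans (max_le (natDegree_map_le.trans hqp) le_rfl)) hq
  rw [mul_div_cancel₀ _ hn.ne', map_sub] at h1
  have h2 : P.polynomialHom (C κ) = 10 * P.polynomialHom (C (κ / 10)) := by
    have := map_mul (P.polynomialHom.comp C) 10 (κ / 10)
    rwa [mul_div_cancel₀ κ (by norm_num), map_ofNat] at this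
  rw [h2, mul_assoc] at hκ
  linarith

/-- If `X` keeps its distance from `R` in two orders, then polynomials over `S` are approximated by
polynomials over `R` in both orders at once, so that the places are determined on `R(X)`. -/
theorem toRealPlace_eq_of_forall_le (hS : IsContinuousClosure R S)
    (h : P.toRealPlace.comap (ratFuncInclusion R S) = Q.toRealPlace.comap (ratFuncInclusion R S))
    {δ₁ δ₂ : S} (hδ₁ : 0 < δ₁) (hδ₂ : 0 < δ₂)
    (hP : ∀ r : R, P.polynomialHom (C δ₁) * (1 + |P.polynomialHom X|) ≤
      |P.polynomialHom X - P.polynomialHom (C (algebraMap R S r))|)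
    (hQ : ∀ r : R, Q.polynomialHom (C δ₂) * (1 + |Q.polynomialHom X|) ≤
      |Q.polynomialHom X - Q.polynomialHom (C (algebraMap R S r))|) :
    P.toRealPlace = Q.toRealPlace := by
  have approx (p : S[X]) (hp : p ≠ 0) : ∃ p' : R[X],
      10 * |P.polynomialHom (p'.map (algebraMap R S)) - P.polynomialHom p| ≤
        |P.polynomialHom p| ∧
      10 * |Q.polynomialHom (p'.map (algebraMap R S)) - Q.polynomialHom p| ≤
        |Q.polynomialHom p| := by
    obtain ⟨ε₁, hε₁, h1⟩ := exists_forall_abs_sub_le hS hδ₁ hP hp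
    obtain ⟨ε₂, hε₂, h2⟩ := exists_forall_abs_sub_le hS hδ₂ hQ hp
    obtain ⟨p', hdeg, hp'⟩ := hS.exists_polynomial_approx p (lt_min hε₁ hε₂)
    exact ⟨p', h1 p' hdeg fun i => (hp' i).trans (min_le_left _ _),
      h2 p' hdeg fun i => (hp' i).trans (min_le_right _ _)⟩
  refine toRealPlace_eq_of_polynomial fun p q hq _ hpq => ?_
  rcases eq_or_ne p 0 with rfl | hp
  · simp
  obtain ⟨p', hp1, hp2⟩ := approx p hp
  obtain ⟨q', hq1, hq2⟩ := approx q hq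
  have hq' : q' ≠ 0 := by
    rintro rfl
    rw [Polynomial.map_zero, map_zero, zero_sub, abs_neg] at hq1
    linarith [abs_pos.2 (P.polynomialHom_ne_zero hq)]
  -- The factors `4` and `5` absorb the relative error of `1 / 10` in both approximations.
  have hC (O : FieldOrder (RatFunc S)) (n : ℕ) (s : R[X]) :
      |O.polynomialHom ((C (n : R) * s).map (algebraMap R S))| =
        n * |O.polynomialHom (s.map (algebraMap R S))| := by
    rw [Polynomial.map_mul, map_mul, abs_mul, map_C, map_natCast, C_eq_natCast, map_natCast,
      Nat.abs_cast]
  have h1 := abs_polynomialHom_map_le h (p := C ((4 : ℕ) : R) * p') (q := C ((5 : ℕ) : R) * q')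
    (mul_ne_zero (C_ne_zero.2 (by norm_num)) hq') (by
      rw [hC, hC]
      push_cast
      have h2 := abs_sub_abs_le_abs_sub (P.polynomialHom (p'.map (algebraMap R S)))
        (P.polynomialHom p)
      have h3 := abs_sub_abs_le_abs_sub (P.polynomialHom q)
        (P.polynomialHom (q'.map (algebraMap R S)))
      rw [abs_sub_comm] at h3
      linarith [abs_nonneg (P.polynomialHom q)])
  rw [hC, hC] at h1
  push_cast at h1
  have h2 := abs_sub_abs_le_abs_sub (Q.polynomialHom (q'.map (algebraMap R S)))
    (Q.polynomialHom q)
  have h3 := abs_sub_abs_le_abs_sub (Q.polynomialHom p)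
    (Q.polynomialHom (p'.map (algebraMap R S)))
  rw [abs_sub_comm] at h3
  linarith [abs_nonneg (Q.polynomialHom q)]

theorem toRealPlace_eq_of_comap_eq (hS : IsContinuousClosure R S)
    (h : P.toRealPlace.comap (ratFuncInclusion R S) = Q.toRealPlace.comap (ratFuncInclusion R S)) :
    P.toRealPlace = Q.toRealPlace := by
  rcases hS.exists_forall_le_or_exists_forall_lt (strictMono_polynomialHom hS P)
    (P.polynomialHom X) with ⟨δ₁, hδ₁, hP⟩ | ⟨a, ha⟩
  · rcases hS.exists_forall_le_or_exists_forall_lt (strictMono_polynomialHom hS Q)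
      (Q.polynomialHom X) with ⟨δ₂, hδ₂, hQ⟩ | ⟨a, ha⟩
    · exact toRealPlace_eq_of_forall_le hS h hδ₁ hδ₂ hP hQ
    · exact toRealPlace_eq_of_forall_lt hS (abs_X_sub_lt_of_comap_eq hS h.symm ha) ha
  · exact toRealPlace_eq_of_forall_lt hS ha (abs_X_sub_lt_of_comap_eq hS h ha)

theorem comap_ratFuncInclusion_injective (hS : IsContinuousClosure R S) :
    Function.Injective (RealPlace.comap (ratFuncInclusion R S)) := fun ξ η hξη => by
  obtain ⟨P, rfl⟩ := toRealPlace_surjective ξ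
  obtain ⟨Q, rfl⟩ := toRealPlace_surjective η
  exact toRealPlace_eq_of_comap_eq hS hξη

end FieldOrder

end Injective

theorem mainTheorem2 {R S : Type*}
    [Field R] [LinearOrder R] [IsStrictOrderedRing R] [IsRealClosed R]
    [Field S] [LinearOrder S] [IsStrictOrderedRing S] [Algebra R S]
    (hS : IsContinuousClosure R S) :
    ∃ e : RealPlace (RatFunc S) ≃ₜ RealPlace (RatFunc R),
      ∀ ξ : RealPlace (RatFunc S), e ξ = ξ.comap (ratFuncInclusion R S) := by
  have hq := RealPlace.isQuotientMap_comap
    (FieldOrder.comap_ratFuncInclusion_surjective hS.strictMono)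
  exact ⟨(isHomeomorph_iff_isQuotientMap_injective.2
    ⟨hq, FieldOrder.comap_ratFuncInclusion_injective hS⟩).homeomorph, fun ξ => rfl⟩
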